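/- Let $\mathfrak g$ be a finite-dimensional real Lie algebra with a fixed norm, let $\mathbb B\subseteq\mathfrak g$ be its open unit ball, and let $U(\mathfrak g)$ be its universal enveloping algebra. Let $V,W,X$ be complex locally convex spaces, $X$ Hausdorff and sequentially complete, with Lie algebra representations $\varrho_V,\varrho_W,\varrho_X$ of $\mathfrak g$ by continuous linear endomorphisms, extended to algebra morphisms on $U(\mathfrak g)$; we write $\Xi\triangleright v$ for these actions. Let $\mu\colon V\otimes W\to X$ be linear, continuous for the projective tensor product topology, and malleable, i.e. $$\xi\triangleright\mu(v\otimes w)=\mu\bigl((\xi\triangleright v)\otimes w+v\otimes(\xi\triangleright w)\bigr)\qquad(\xi\in\mathfrak g,\ v\in V,\ w\in W).$$ For $Z\in\{V,W,X\}$ let $\mathrm{cs}(Z)$ be the set of continuous seminorms of $Z$. For $R\ge 0$, $r\ge 0$ and $q\in\mathrm{cs}(Z)$ put $$p^{(R)}_{r,q}(z)=\sum_{n=0}^\infty n!^{R-1}r^n\sup_{\xi_1,\dots,\xi_n\in\mathbb B}q(\xi_1\cdots\xi_n\triangleright z)\in[0,\infty],$$ and let $\mathcal E_R(\varrho_Z)=\{z\in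 Z : p^{(R)}_{r,q}(z)<\infty \text{ for all } r\ge 0,\ q\in\mathrm{cs}(Z)\}$ be the space of entire vectors of order $R$, with the locally convex topology given by all the seminorms $p^{(R)}_{r,q}$; the representation $\varrho_Z$ restricts to a representation on it by continuous linear endomorphisms. Tensor products of complex spaces are over $\mathbb C$ and carry the projective topology; $p\otimes p'$ is the projective tensor product of the seminorms $p,p'$, that is, $(p\otimes p')(z)=\inf\sum_i p(v_i)p'(w_i)$ over all representations $z=\sum_i v_i\otimes w_i$. Fix $R\ge 0$ and let $F_\hbar=\sum_{n=0}^\infty\frac{\hbar^n}{n!}F_n$ be a formal power series with coefficients $F_n\in U(\mathfrak g)\otimes U(\mathfrak g)$ (complex scalars being allowed, i.e. $F_n\in\mathbb C\otimes_{\mathbb R}(U(\mathfrak g)\otimes_{\mathbb R}U(\mathfrak g))$). Assume that for every $r>0$, $q_V\in\mathrm{cs}(V)$, $q_W\in\mathrm{cs}(W)$ and every compact $K\subseteq\mathbb C$ there are $q_V'\in\mathrm{cs}(V)$, $q_W'\in\mathrm{cs}(W)$ and $t,C>0$ such that $$\Bigl(p^{(R)}_{r,q_V}\otimes p^{(R)}_{r,q_W}\Bigr)\Bigl(\tfrac{\hbar^n}{n!}F_n\triangleright(v\otimes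 w)\Bigr)\le C\,p^{(R)}_{tr,q_V'}(v)\,p^{(R)}_{tr,q_W'}(w)$$ for all $v\in\mathcal E_R(\varrho_V)$, $w\in\mathcal E_R(\varrho_W)$, $\hbar\in K$ and $n\in\mathbb N_0$, where the left-hand seminorm is that of $\mathcal E_R(\varrho_V)\otimes\mathcal E_R(\varrho_W)$. Then $\mu$ induces a linear map $\mathcal E_R(\varrho_V)\otimes\mathcal E_R(\varrho_W)\to\mathcal E_R(\varrho_X)$, and for all $\hbar\in\mathbb C$ and $z\in\mathcal E_R(\varrho_V)\otimes\mathcal E_R(\varrho_W)$ the series $$\mu_{F_\hbar}(z)=\sum_{n=0}^\infty\frac{\hbar^n}{n!}\,\mu(F_n\triangleright z)$$ converges in $\mathcal E_R(\varrho_X)$. For every $\hbar\in\mathbb C$ the map $\mu_{F_\hbar}\colon\mathcal E_R(\varrho_V)\otimes\mathcal E_R(\varrho_W)\to\mathcal E_R(\varrho_X)$ is linear and continuous for the projective topology, so that it makes $(\mathcal E_R(\varrho_V),\mathcal E_R(\varrho_W),\mathcal E_R(\varrho_X))$ a continuous $\mathfrak g$-triple. Moreover the map $(\hbar,z)\mapsto\mu_{F_\hbar}(z)$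 is Fréchet holomorphic (continuous and complex Fréchet differentiable at every point) on $\mathbb C\times\bigl(\mathcal E_R(\varrho_V)\otimes\mathcal E_R(\varrho_W)\bigr)$, and hence on $K^\circ\times\bigl(\mathcal E_R(\varrho_V)\otimes\mathcal E_R(\varrho_W)\bigr)$ for every compact $K\subseteq\mathbb C$. -/

import Mathlib

open scoped TensorProduct NNReal ENNReal

attribute [local instance] LieRing.ofAssociativeRing

noncomputable section

namespace UDF

/-! ### Continuous seminorms and sequential completeness -/

/-- The set `cs(V)` of continuous seminorms of a complex topological vector space. -/
abbrev CS (V : Type*) [AddCommGroup V] [Module ℂ V] [TopologicalSpace V] : Type _ :=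
  {q : Seminorm ℂ V // Continuous q}

instance CS.instNonempty (V : Type*) [AddCommGroup V] [Module ℂ V] [TopologicalSpace V] :
    Nonempty (CS V) :=
  ⟨⟨0, continuous_const⟩⟩

/-- Sequential completeness of a topological vector space: every Cauchy sequence converges. -/
def SeqComplete (X : Type*) [AddCommGroup X] [TopologicalSpace X] : Prop :=
  ∀ u : ℕ → X, Filter.Tendsto (fun p : ℕ × ℕ => u p.1 - u p.2) Filter.atTop (nhds 0) →
    ∃ x, Filter.Tendsto u Filter.atTop (nhds x)

/-- Fréchet holomorphy of a map between complex topological vector spaces on an open set: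
the map is continuous and complex (Fréchet) differentiable at every point of the set. -/
def FrechetHolomorphicOn {E F : Type*} [AddCommGroup E] [Module ℂ E] [TopologicalSpace E]
    [AddCommGroup F] [Module ℂ F] [TopologicalSpace F] (f : E → F) (U : Set E) : Prop :=
  IsOpen U ∧ ContinuousOn f U ∧ DifferentiableOn ℂ f U

/-! ### Projective tensor products -/

section Projective

variable {V W : Type*} [AddCommGroup V] [Module ℂ V] [AddCommGroup W] [Module ℂ W]

/-- A list of pairs represents the tensor `∑ v_i ⊗ w_i`. -/
def tensorOfList (l : List (V × W)) : V ⊗[ℂ] W :=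
  (l.map fun x => x.1 ⊗ₜ[ℂ] x.2).sum

/-- The number `∑ p(v_i) q(w_i)` of a representation of a tensor. -/
def costOfList (p : Seminorm ℂ V) (q : Seminorm ℂ W) (l : List (V × W)) : ℝ :=
  (l.map fun x => p x.1 * q x.2).sum

theorem tensorOfList_surjective (z : V ⊗[ℂ] W) : ∃ l : List (V × W), tensorOfList l = z := by
  induction z using TensorProduct.induction_on with
  | zero => exact ⟨[], by simp [tensorOfList]⟩
  | tmul v w => exact ⟨[(v, w)], by simp [tensorOfList]⟩
  | add x y hx hy =>
    obtain ⟨l, rfl⟩ := hx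
    obtain ⟨m, rfl⟩ := hy
    exact ⟨l ++ m, by simp [tensorOfList]⟩

theorem costOfList_nonneg (p : Seminorm ℂ V) (q : Seminorm ℂ W) (l : List (V × W)) :
    0 ≤ costOfList p q l := by
  apply List.sum_nonneg
  intro a ha
  obtain ⟨x, -, rfl⟩ := List.mem_map.1 ha
  exact mul_nonneg (apply_nonneg p _) (apply_nonneg q _)

/-- `(p ⊗ q)(z)` is the infimum of `∑ p(v_i) q(w_i)` over all representations
`z = ∑ v_i ⊗ w_i`. -/
def projFun (p : Seminorm ℂ V) (q : Seminorm ℂ W) (z : V ⊗[ℂ] W) : ℝ :=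
  ⨅ l : {l : List (V × W) // tensorOfList l = z}, costOfList p q l

theorem projFun_le (p : Seminorm ℂ V) (q : Seminorm ℂ W) (l : List (V × W)) :
    projFun p q (tensorOfList l) ≤ costOfList p q l :=
  ciInf_le (f := fun m : {m : List (V × W) // tensorOfList m = tensorOfList l} =>
    costOfList p q m) ⟨0, by rintro _ ⟨m, rfl⟩; exact costOfList_nonneg p q m⟩ ⟨l, rfl⟩

theorem exists_lt_of_projFun (p : Seminorm ℂ V) (q : Seminorm ℂ W) (z : V ⊗[ℂ] W) {ε : ℝ}
    (hε : 0 < ε) : ∃ l : List (V × W), tensorOfList l = z ∧ costOfList p q l < projFun p q z + ε := by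
  obtain ⟨l₀, hl₀⟩ := tensorOfList_surjective z
  have : Nonempty {l : List (V × W) // tensorOfList l = z} := ⟨⟨l₀, hl₀⟩⟩
  obtain ⟨l, hl⟩ := exists_lt_of_ciInf_lt
    (show (⨅ l : {l : List (V × W) // tensorOfList l = z}, costOfList p q l) < projFun p q z + ε
      from lt_add_of_pos_right _ hε)
  exact ⟨l.1, l.2, hl⟩

/-- The projective tensor product `p ⊗ q` of two seminorms. -/
def projSeminorm (p : Seminorm ℂ V) (q : Seminorm ℂ W) : Seminorm ℂ (V ⊗[ℂ] W) :=
  Seminorm.ofSMulLE (projFun p q)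
    (by
      refine le_antisymm ?_ (Real.iInf_nonneg fun l => costOfList_nonneg p q l)
      simpa [tensorOfList, costOfList] using projFun_le p q ([] : List (V × W)))
    (by
      intro x y
      refine le_of_forall_pos_lt_add fun ε hε => ?_
      obtain ⟨l, rfl, hl⟩ := exists_lt_of_projFun p q x (half_pos hε)
      obtain ⟨m, rfl, hm⟩ := exists_lt_of_projFun p q y (half_pos hε)
      have h := projFun_le p q (l ++ m)
      have h1 : tensorOfList (l ++ m) = tensorOfList l + tensorOfList m := by
        simp [tensorOfList]
      have h2 : costOfList p q (l ++ m) = costOfList p q l + costOfList p q m := by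
        simp [costOfList]
      rw [h1, h2] at h
      linarith)
    (by
      intro c z
      refine le_of_forall_pos_lt_add fun ε hε => ?_
      obtain ⟨l, rfl, hl⟩ := exists_lt_of_projFun p q z
        (show 0 < ε / (‖c‖ + 1) by positivity)
      have h := projFun_le p q (l.map fun x => (c • x.1, x.2))
      have h1 : tensorOfList (l.map fun x => (c • x.1, x.2)) = c • tensorOfList l := by
        simp only [tensorOfList, List.map_map, List.smul_sum]
        rfl
      have h2 : costOfList p q (l.map fun x => (c • x.1, x.2)) = ‖c‖ * costOfList p q l := by
        simp only [costOfList, List.map_map, ← List.sum_map_mul_left]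
        congr 1
        apply List.map_congr_left
        intro x _
        simp [map_smul_eq_mul, mul_assoc]
      rw [h1, h2] at h
      refine lt_of_le_of_lt h ?_
      have h3 : ‖c‖ * (ε / (‖c‖ + 1)) < ε := by
        rw [mul_div_assoc', div_lt_iff₀ (by positivity)]
        nlinarith [norm_nonneg c]
      nlinarith [norm_nonneg c, mul_le_mul_of_nonneg_left hl.le (norm_nonneg c)])

theorem projSeminorm_apply (p : Seminorm ℂ V) (q : Seminorm ℂ W) (z : V ⊗[ℂ] W) :
    projSeminorm p q z = ⨅ l : {l : List (V × W) // tensorOfList l = z}, costOfList p q l :=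
  rfl

/-- The defining seminorms `p ⊗ q`, for `p ∈ cs(V)`, `q ∈ cs(W)`, of the projective topology. -/
def projFamily (V W : Type*) [AddCommGroup V] [Module ℂ V] [TopologicalSpace V]
    [AddCommGroup W] [Module ℂ W] [TopologicalSpace W] :
    SeminormFamily ℂ (V ⊗[ℂ] W) (CS V × CS W) :=
  fun i => projSeminorm i.1.1 i.2.1

/-- The projective tensor product topology. -/
instance projTopology (V W : Type*) [AddCommGroup V] [Module ℂ V] [TopologicalSpace V]
    [AddCommGroup W] [Module ℂ W] [TopologicalSpace W] : TopologicalSpace (V ⊗[ℂ] W) :=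
  (projFamily V W).moduleFilterBasis.topology

end Projective

/-! ### Analytic and entire vectors -/

section Entire

variable {𝔤 : Type*} [LieRing 𝔤] [LieAlgebra ℝ 𝔤]
variable {V : Type*} [AddCommGroup V] [Module ℂ V] [TopologicalSpace V]
  [IsTopologicalAddGroup V] [ContinuousSMul ℂ V]

/-- `sup q(ξ₁ ⋯ ξ_n ▹ v)` over all `ξ₁, …, ξ_n` in the open unit ball of the norm `N` of `𝔤`. -/
def supTerm (N : Seminorm ℝ 𝔤) (ρ : 𝔤 →ₗ⁅ℝ⁆ (V →L[ℂ] V)) (q : Seminorm ℂ V) (n : ℕ) (v : V) :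
    ℝ≥0∞ :=
  ⨆ (ξ : Fin n → 𝔤) (_ : ∀ i, N (ξ i) < 1),
    ENNReal.ofReal (q ((List.ofFn fun i => ρ (ξ i)).prod v))

/-- The coefficient `n!^(R-1) r^n`. -/
def coeffTerm (R r : ℝ≥0) (n : ℕ) : ℝ≥0 :=
  (n.factorial : ℝ≥0) ^ ((R : ℝ) - 1) * r ^ n

/-- The (possibly infinite) seminorm
`p_{r,q}^{(R)}(v) = ∑ n!^(R-1) r^n sup q(ξ₁ ⋯ ξ_n ▹ v)`. -/
def analyticSeminorm (N : Seminorm ℝ 𝔤) (ρ : 𝔤 →ₗ⁅ℝ⁆ (V →L[ℂ] V)) (R r : ℝ≥0)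
    (q : Seminorm ℂ V) (v : V) : ℝ≥0∞ :=
  ∑' n : ℕ, (coeffTerm R r n : ℝ≥0∞) * supTerm N ρ q n v

theorem supTerm_zero (N : Seminorm ℝ 𝔤) (ρ : 𝔤 →ₗ⁅ℝ⁆ (V →L[ℂ] V)) (q : Seminorm ℂ V) (n : ℕ) :
    supTerm N ρ q n 0 = 0 := by
  simp [supTerm]

theorem supTerm_add_le (N : Seminorm ℝ 𝔤) (ρ : 𝔤 →ₗ⁅ℝ⁆ (V →L[ℂ] V)) (q : Seminorm ℂ V) (n : ℕ)
    (v w : V) : supTerm N ρ q n (v + w) ≤ supTerm N ρ q n v + supTerm N ρ q n w := by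
  refine iSup₂_le fun ξ hξ => ?_
  rw [map_add]
  refine (ENNReal.ofReal_le_ofReal (map_add_le_add q _ _)).trans ?_
  rw [ENNReal.ofReal_add (apply_nonneg q _) (apply_nonneg q _)]
  exact add_le_add
    (le_iSup₂ (f := fun (ξ : Fin n → 𝔤) (_ : ∀ i, N (ξ i) < 1) =>
      ENNReal.ofReal (q ((List.ofFn fun i => ρ (ξ i)).prod v))) ξ hξ)
    (le_iSup₂ (f := fun (ξ : Fin n → 𝔤) (_ : ∀ i, N (ξ i) < 1) =>
      ENNReal.ofReal (q ((List.ofFn fun i => ρ (ξ i)).prod w))) ξ hξ)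

theorem supTerm_smul (N : Seminorm ℝ 𝔤) (ρ : 𝔤 →ₗ⁅ℝ⁆ (V →L[ℂ] V)) (q : Seminorm ℂ V) (n : ℕ)
    (c : ℂ) (v : V) : supTerm N ρ q n (c • v) = ENNReal.ofReal ‖c‖ * supTerm N ρ q n v := by
  simp only [supTerm, ENNReal.mul_iSup, map_smul, map_smul_eq_mul,
    ENNReal.ofReal_mul (norm_nonneg c)]

/-- Moving a fixed Lie algebra element into the supremum. -/
theorem supTerm_rep_le (N : Seminorm ℝ 𝔤) (ρ : 𝔤 →ₗ⁅ℝ⁆ (V →L[ℂ] V)) (q : Seminorm ℂ V) (n : ℕ)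
    (η : 𝔤) (v : V) :
    supTerm N ρ q n (ρ η v) ≤ ENNReal.ofReal (N η + 1) * supTerm N ρ q (n + 1) v := by
  have hc : 0 < N η + 1 := by have := apply_nonneg N η; linarith
  refine iSup₂_le fun ξ hξ => ?_
  set ζ : Fin (n + 1) → 𝔤 := Fin.snoc ξ ((N η + 1)⁻¹ • η) with hζ
  have hball : ∀ i, N (ζ i) < 1 := by
    intro i
    refine Fin.lastCases ?_ (fun j => ?_) i
    · simp only [hζ, Fin.snoc_last, map_smul_eq_mul, norm_inv, Real.norm_eq_abs, abs_of_pos hc]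
      rw [inv_mul_lt_iff₀ hc]
      linarith
    · simpa [hζ] using hξ j
  have key : (List.ofFn fun i => ρ (ξ i)).prod (ρ η v)
      = ((N η + 1 : ℝ) : ℂ) • (List.ofFn fun i => ρ (ζ i)).prod v := by
    have h1 : (List.ofFn fun i => ρ (ζ i))
        = (List.ofFn fun i => ρ (ξ i)) ++ [ρ ((N η + 1)⁻¹ • η)] := by
      rw [List.ofFn_succ_last]
      simp [hζ]
    have h2 : ρ η = ((N η + 1 : ℝ) : ℂ) • ρ ((N η + 1)⁻¹ • η) := by
      rw [Complex.coe_smul, ← map_smul, smul_smul, mul_inv_cancel₀ hc.ne', one_smul]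
    rw [h1, List.prod_append, List.prod_singleton]
    conv_lhs => rw [h2]
    rw [smul_apply, map_smul]
    rfl
  rw [key, map_smul_eq_mul, Complex.norm_real, Real.norm_eq_abs, abs_of_pos hc,
    ENNReal.ofReal_mul hc.le]
  gcongr
  exact le_iSup₂ (f := fun (ξ : Fin (n + 1) → 𝔤) (_ : ∀ i, N (ξ i) < 1) =>
      ENNReal.ofReal (q ((List.ofFn fun i => ρ (ξ i)).prod v))) ζ hball

theorem coeffTerm_le (R r : ℝ≥0) (n : ℕ) :
    coeffTerm R r n ≤ coeffTerm R (max 1 (2 * r)) (n + 1) := by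
  have hf : (0 : ℝ≥0) < (n.factorial : ℝ≥0) := by exact_mod_cast n.factorial_pos
  have hn : (1 : ℝ≥0) ≤ ((n + 1 : ℕ) : ℝ≥0) := by exact_mod_cast Nat.succ_le_succ n.zero_le
  have h2 : ((n + 1 : ℕ) : ℝ≥0) ≤ 2 ^ n := by exact_mod_cast Nat.lt_two_pow_self (n := n)
  set x : ℝ≥0 := ((n + 1 : ℕ) : ℝ≥0) with hx
  set s : ℝ≥0 := max 1 (2 * r) with hs
  have hxpos : (0 : ℝ≥0) < x := lt_of_lt_of_le one_pos hn
  have hxR : 1 ≤ x * x ^ ((R : ℝ) - 1) := by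
    have : x * x ^ ((R : ℝ) - 1) = x ^ (R : ℝ) := by
      conv_lhs => enter [1]; rw [← NNReal.rpow_one x]
      rw [← NNReal.rpow_add hxpos.ne']
      congr 1
      ring
    rw [this]
    exact NNReal.one_le_rpow hn R.2
  have hsn : x * r ^ n ≤ s ^ (n + 1) := by
    calc x * r ^ n ≤ 2 ^ n * r ^ n := by gcongr
      _ = (2 * r) ^ n := (mul_pow _ _ _).symm
      _ ≤ s ^ n := by gcongr; exact le_max_right _ _
      _ ≤ s ^ (n + 1) := pow_le_pow_right₀ (le_max_left _ _) n.le_succ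
  have hfac : ((n + 1).factorial : ℝ≥0) = x * (n.factorial : ℝ≥0) := by
    rw [Nat.factorial_succ]; push_cast; rw [hx]; push_cast; rfl
  unfold coeffTerm
  rw [hfac, NNReal.mul_rpow]
  calc (n.factorial : ℝ≥0) ^ ((R : ℝ) - 1) * r ^ n
      ≤ (n.factorial : ℝ≥0) ^ ((R : ℝ) - 1) * r ^ n * (x * x ^ ((R : ℝ) - 1)) :=
        le_mul_of_one_le_right (zero_le) hxR
    _ = x ^ ((R : ℝ) - 1) * (n.factorial : ℝ≥0) ^ ((R : ℝ) - 1) * (x * r ^ n) := by ring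
    _ ≤ x ^ ((R : ℝ) - 1) * (n.factorial : ℝ≥0) ^ ((R : ℝ) - 1) * s ^ (n + 1) := by gcongr

theorem analyticSeminorm_zero (N : Seminorm ℝ 𝔤) (ρ : 𝔤 →ₗ⁅ℝ⁆ (V →L[ℂ] V)) (R r : ℝ≥0)
    (q : Seminorm ℂ V) : analyticSeminorm N ρ R r q 0 = 0 := by
  simp [analyticSeminorm, supTerm_zero]

theorem analyticSeminorm_add_le (N : Seminorm ℝ 𝔤) (ρ : 𝔤 →ₗ⁅ℝ⁆ (V →L[ℂ] V)) (R r : ℝ≥0)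
    (q : Seminorm ℂ V) (v w : V) :
    analyticSeminorm N ρ R r q (v + w)
      ≤ analyticSeminorm N ρ R r q v + analyticSeminorm N ρ R r q w := by
  unfold analyticSeminorm
  rw [← ENNReal.tsum_add]
  refine ENNReal.tsum_le_tsum fun n => ?_
  rw [← mul_add]
  gcongr
  exact supTerm_add_le N ρ q n v w

theorem analyticSeminorm_smul (N : Seminorm ℝ 𝔤) (ρ : 𝔤 →ₗ⁅ℝ⁆ (V →L[ℂ] V)) (R r : ℝ≥0)
    (q : Seminorm ℂ V) (c : ℂ) (v : V) :
    analyticSeminorm N ρ R r q (c • v) = ENNReal.ofReal ‖c‖ * analyticSeminorm N ρ R r q v := by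
  unfold analyticSeminorm
  rw [← ENNReal.tsum_mul_left]
  refine tsum_congr fun n => ?_
  rw [supTerm_smul, mul_left_comm]

theorem analyticSeminorm_rep_le (N : Seminorm ℝ 𝔤) (ρ : 𝔤 →ₗ⁅ℝ⁆ (V →L[ℂ] V)) (R r : ℝ≥0)
    (q : Seminorm ℂ V) (η : 𝔤) (v : V) :
    analyticSeminorm N ρ R r q (ρ η v)
      ≤ ENNReal.ofReal (N η + 1) * analyticSeminorm N ρ R (max 1 (2 * r)) q v := by
  unfold analyticSeminorm
  calc ∑' n : ℕ, (coeffTerm R r n : ℝ≥0∞) * supTerm N ρ q n (ρ η v)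
      ≤ ∑' n : ℕ, ENNReal.ofReal (N η + 1) *
          ((coeffTerm R (max 1 (2 * r)) (n + 1) : ℝ≥0∞) * supTerm N ρ q (n + 1) v) := by
        refine ENNReal.tsum_le_tsum fun n => ?_
        rw [mul_left_comm]
        gcongr
        · exact coeffTerm_le R r n
        · exact supTerm_rep_le N ρ q n η v
    _ = ENNReal.ofReal (N η + 1) * ∑' n : ℕ,
          (coeffTerm R (max 1 (2 * r)) (n + 1) : ℝ≥0∞) * supTerm N ρ q (n + 1) v :=
        ENNReal.tsum_mul_left
    _ ≤ _ := by
        refine mul_le_mul_right ?_ _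
        exact ENNReal.tsum_comp_le_tsum_of_injective (add_left_injective 1)
          (fun n : ℕ => (coeffTerm R (max 1 (2 * r)) n : ℝ≥0∞) * supTerm N ρ q n v)

/-- The space `A_{R,r₀}(ρ)` of analytic vectors of order `R` and with radius of convergence at
least `r₀`. -/
def analyticVectors (N : Seminorm ℝ 𝔤) (ρ : 𝔤 →ₗ⁅ℝ⁆ (V →L[ℂ] V)) (R r₀ : ℝ≥0) :
    Submodule ℂ V where
  carrier := {v | ∀ q : CS V, ∀ r : ℝ≥0, r < r₀ → analyticSeminorm N ρ R r q.1 v < ∞}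
  zero_mem' := by
    intro q r _
    simp [analyticSeminorm_zero]
  add_mem' := by
    intro v w hv hw q r hr
    exact (analyticSeminorm_add_le N ρ R r q.1 v w).trans_lt
      (ENNReal.add_lt_top.2 ⟨hv q r hr, hw q r hr⟩)
  smul_mem' := by
    intro c v hv q r hr
    rw [analyticSeminorm_smul]
    exact ENNReal.mul_lt_top ENNReal.ofReal_lt_top (hv q r hr)

/-- The subspace `E_R(ρ) = ⋂_{r₀ > 0} A_{R,r₀}(ρ)` of entire vectors of order `R`. -/
def entireVectors (N : Seminorm ℝ 𝔤) (ρ : 𝔤 →ₗ⁅ℝ⁆ (V →L[ℂ] V)) (R : ℝ≥0) : Submodule ℂ V :=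
  ⨅ r₀ : {r₀ : ℝ≥0 // 0 < r₀}, analyticVectors N ρ R r₀.1

theorem mem_entireVectors {N : Seminorm ℝ 𝔤} {ρ : 𝔤 →ₗ⁅ℝ⁆ (V →L[ℂ] V)} {R : ℝ≥0} {v : V} :
    v ∈ entireVectors N ρ R ↔ ∀ (q : CS V) (r : ℝ≥0), analyticSeminorm N ρ R r q.1 v < ∞ := by
  simp only [entireVectors, Submodule.mem_iInf]
  constructor
  · intro h q r
    exact h ⟨r + 1, by positivity⟩ q r (lt_add_of_pos_right r one_pos)
  · intro h r₀ q r _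
    exact h q r

/-- The space of entire vectors, as a type of its own: its topology is generated by the seminorms
`p_{r,q}^{(R)}` and is in general finer than the subspace topology. -/
def Entire (N : Seminorm ℝ 𝔤) (ρ : 𝔤 →ₗ⁅ℝ⁆ (V →L[ℂ] V)) (R : ℝ≥0) : Type _ :=
  ↥(entireVectors N ρ R)

namespace Entire

variable (N : Seminorm ℝ 𝔤) (ρ : 𝔤 →ₗ⁅ℝ⁆ (V →L[ℂ] V)) (R : ℝ≥0)

instance instAddCommGroup : AddCommGroup (Entire N ρ R) :=
  inferInstanceAs (AddCommGroup ↥(entireVectors N ρ R))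

instance instModule : Module ℂ (Entire N ρ R) :=
  inferInstanceAs (Module ℂ ↥(entireVectors N ρ R))

/-- The inclusion `E_R(ρ) → V`. -/
def incl : Entire N ρ R →ₗ[ℂ] V := (entireVectors N ρ R).subtype

theorem incl_lt_top (q : CS V) (r : ℝ≥0) (v : Entire N ρ R) :
    analyticSeminorm N ρ R r q.1 (incl N ρ R v) < ∞ :=
  mem_entireVectors.1 v.2 q r

/-- The seminorm `p_{r,q}^{(R)}` on the space of entire vectors, where it is finite. -/
def seminorm (r : ℝ≥0) (q : CS V) : Seminorm ℂ (Entire N ρ R) :=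
  Seminorm.of (fun v => (analyticSeminorm N ρ R r q.1 (incl N ρ R v)).toReal)
    (by
      intro v w
      rw [map_add, ← ENNReal.toReal_add (incl_lt_top N ρ R q r v).ne (incl_lt_top N ρ R q r w).ne]
      exact ENNReal.toReal_mono
        (ENNReal.add_lt_top.2 ⟨incl_lt_top N ρ R q r v, incl_lt_top N ρ R q r w⟩).ne
        (analyticSeminorm_add_le N ρ R r q.1 _ _))
    (by
      intro c v
      rw [map_smul, analyticSeminorm_smul, ENNReal.toReal_mul,
        ENNReal.toReal_ofReal (norm_nonneg c)])

theorem seminorm_apply (r : ℝ≥0) (q : CS V) (v : Entire N ρ R) :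
    seminorm N ρ R r q v = (analyticSeminorm N ρ R r q.1 (incl N ρ R v)).toReal :=
  rfl

/-- The defining seminorms of the topology of `E_R(ρ)`. -/
def family : SeminormFamily ℂ (Entire N ρ R) (ℝ≥0 × CS V) :=
  fun i => seminorm N ρ R i.1 i.2

instance instTopologicalSpace : TopologicalSpace (Entire N ρ R) :=
  (family N ρ R).moduleFilterBasis.topology

theorem withSeminorms : WithSeminorms (family N ρ R) := ⟨rfl⟩

instance instIsTopologicalAddGroup : IsTopologicalAddGroup (Entire N ρ R) :=
  (withSeminorms N ρ R).topologicalAddGroup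

instance instContinuousSMul : ContinuousSMul ℂ (Entire N ρ R) :=
  (withSeminorms N ρ R).continuousSMul

instance instLocallyConvexSpace : LocallyConvexSpace ℝ (Entire N ρ R) :=
  (withSeminorms N ρ R).toLocallyConvexSpace

theorem rep_mem (ξ : 𝔤) (v : Entire N ρ R) : ρ ξ (incl N ρ R v) ∈ entireVectors N ρ R := by
  rw [mem_entireVectors]
  intro q r
  exact (analyticSeminorm_rep_le N ρ R r q.1 ξ _).trans_lt
    (ENNReal.mul_lt_top ENNReal.ofReal_lt_top (incl_lt_top N ρ R q _ v))

/-- The restriction of `ρ ξ` to the entire vectors, as a linear map. -/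
def repLinear (ξ : 𝔤) : Entire N ρ R →ₗ[ℂ] Entire N ρ R :=
  LinearMap.codRestrict (entireVectors N ρ R) ((ρ ξ).toLinearMap ∘ₗ incl N ρ R) (rep_mem N ρ R ξ)

theorem repLinear_continuous (ξ : 𝔤) : Continuous (repLinear N ρ R ξ) := by
  refine WithSeminorms.continuous_of_isBounded (withSeminorms N ρ R) (withSeminorms N ρ R) _ ?_
  rintro ⟨r, q⟩
  refine ⟨{(max 1 (2 * r), q)}, ⟨N ξ + 1, by have := apply_nonneg N ξ; linarith⟩, ?_⟩
  intro v
  have hc : 0 ≤ N ξ + 1 := by have := apply_nonneg N ξ; linarith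
  have h := ENNReal.toReal_mono
    (ENNReal.mul_lt_top ENNReal.ofReal_lt_top (incl_lt_top N ρ R q (max 1 (2 * r)) v)).ne
    (analyticSeminorm_rep_le N ρ R r q.1 ξ (incl N ρ R v))
  rw [ENNReal.toReal_mul, ENNReal.toReal_ofReal hc] at h
  rw [Finset.sup_singleton]
  exact h

/-- The representation of `𝔤` on the entire vectors by restriction of `ρ`. -/
def rep : 𝔤 →ₗ⁅ℝ⁆ (Entire N ρ R →L[ℂ] Entire N ρ R) where
  toFun ξ := ⟨repLinear N ρ R ξ, repLinear_continuous N ρ R ξ⟩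
  map_add' ξ η := by
    ext v
    apply Subtype.ext
    change ρ (ξ + η) _ = ρ ξ _ + ρ η _
    rw [map_add]; rfl
  map_smul' c ξ := by
    ext v
    apply Subtype.ext
    change ρ (c • ξ) _ = (c : ℂ) • ρ ξ _
    rw [map_smul]; rfl
  map_lie' := by
    intro ξ η
    ext v
    apply Subtype.ext
    change ρ ⁅ξ, η⁆ _ = ρ ξ (ρ η _) - ρ η (ρ ξ _)
    rw [LieHom.map_lie]; rfl

theorem incl_rep (ξ : 𝔤) (v : Entire N ρ R) :
    incl N ρ R (rep N ρ R ξ v) = ρ ξ (incl N ρ R v) :=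
  rfl

end Entire

end Entire

/-! ### The action of the universal enveloping algebra -/

/-- `U(𝔤) ⊗ U(𝔤)` with complex coefficients. -/
abbrev UU (𝔤 : Type*) [LieRing 𝔤] [LieAlgebra ℝ 𝔤] : Type _ :=
  ℂ ⊗[ℝ] (UniversalEnvelopingAlgebra ℝ 𝔤 ⊗[ℝ] UniversalEnvelopingAlgebra ℝ 𝔤)

section Action

variable {𝔤 : Type*} [LieRing 𝔤] [LieAlgebra ℝ 𝔤]
variable {V : Type*} [AddCommGroup V] [Module ℂ V] [TopologicalSpace V]
  [IsTopologicalAddGroup V] [ContinuousSMul ℂ V]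
variable {W : Type*} [AddCommGroup W] [Module ℂ W] [TopologicalSpace W]
  [IsTopologicalAddGroup W] [ContinuousSMul ℂ W]

/-- The extension of a representation to the universal enveloping algebra. -/
def uAction (ρ : 𝔤 →ₗ⁅ℝ⁆ (V →L[ℂ] V)) : UniversalEnvelopingAlgebra ℝ 𝔤 →ₐ[ℝ] (V →L[ℂ] V) :=
  UniversalEnvelopingAlgebra.lift ℝ ρ

/-- The action of `U(𝔤) ⊗ U(𝔤)` on `V ⊗ W`, given by
`(c ⊗ (a ⊗ b)) ▹ (v ⊗ w) = c (a ▹ v) ⊗ (b ▹ w)`. -/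
def uuAction (ρV : 𝔤 →ₗ⁅ℝ⁆ (V →L[ℂ] V)) (ρW : 𝔤 →ₗ⁅ℝ⁆ (W →L[ℂ] W)) :
    UU 𝔤 →ₗ[ℂ] Module.End ℂ (V ⊗[ℂ] W) :=
  LinearMap.liftBaseChange ℂ
    (TensorProduct.lift
      (LinearMap.mk₂ ℝ
        (fun a b => (TensorProduct.map (uAction ρV a).toLinearMap (uAction ρW b).toLinearMap :
          Module.End ℂ (V ⊗[ℂ] W)))
        (by intro a a' b; rw [map_add]; exact TensorProduct.map_add_left _ _ _)
        (by
          intro c a b; rw [map_smul]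
          exact TensorProduct.map_smul_left (c : ℂ) _ _)
        (by intro a b b'; rw [map_add]; exact TensorProduct.map_add_right _ _ _)
        (by
          intro c a b; rw [map_smul]
          exact TensorProduct.map_smul_right (c : ℂ) _ _)))

theorem uuAction_tmul (ρV : 𝔤 →ₗ⁅ℝ⁆ (V →L[ℂ] V)) (ρW : 𝔤 →ₗ⁅ℝ⁆ (W →L[ℂ] W)) (c : ℂ)
    (a b : UniversalEnvelopingAlgebra ℝ 𝔤) (v : V) (w : W) :
    uuAction ρV ρW (c ⊗ₜ (a ⊗ₜ b)) (v ⊗ₜ w) = c • (uAction ρV a v ⊗ₜ[ℂ] uAction ρW b w) := by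
  simp [uuAction]

end Action

/-! ### Triples -/

/-- A `𝔤`-triple: representations of `𝔤` by continuous endomorphisms of `V`, `W`, `X`, and a
linear map `V ⊗ W → X`. -/
structure GTriple (𝔤 : Type*) [LieRing 𝔤] [LieAlgebra ℝ 𝔤]
    (V : Type*) [AddCommGroup V] [Module ℂ V] [TopologicalSpace V]
    [IsTopologicalAddGroup V] [ContinuousSMul ℂ V] [LocallyConvexSpace ℝ V]
    (W : Type*) [AddCommGroup W] [Module ℂ W] [TopologicalSpace W]
    [IsTopologicalAddGroup W] [ContinuousSMul ℂ W] [LocallyConvexSpace ℝ W]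
    (X : Type*) [AddCommGroup X] [Module ℂ X] [TopologicalSpace X]
    [IsTopologicalAddGroup X] [ContinuousSMul ℂ X] [LocallyConvexSpace ℝ X] where
  ρV : 𝔤 →ₗ⁅ℝ⁆ (V →L[ℂ] V)
  ρW : 𝔤 →ₗ⁅ℝ⁆ (W →L[ℂ] W)
  ρX : 𝔤 →ₗ⁅ℝ⁆ (X →L[ℂ] X)
  μ : V ⊗[ℂ] W →ₗ[ℂ] X

namespace GTriple

variable {𝔤 : Type*} [LieRing 𝔤] [LieAlgebra ℝ 𝔤]
variable {V : Type*} [AddCommGroup V] [Module ℂ V] [TopologicalSpace V]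
  [IsTopologicalAddGroup V] [ContinuousSMul ℂ V] [LocallyConvexSpace ℝ V]
variable {W : Type*} [AddCommGroup W] [Module ℂ W] [TopologicalSpace W]
  [IsTopologicalAddGroup W] [ContinuousSMul ℂ W] [LocallyConvexSpace ℝ W]
variable {X : Type*} [AddCommGroup X] [Module ℂ X] [TopologicalSpace X]
  [IsTopologicalAddGroup X] [ContinuousSMul ℂ X] [LocallyConvexSpace ℝ X]

/-- Continuity with respect to the projective tensor product topology. -/
def IsContinuous (T : GTriple 𝔤 V W X) : Prop :=
  Continuous T.μ

/-- The Leibniz rule. -/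
def IsMalleable (T : GTriple 𝔤 V W X) : Prop :=
  ∀ (ξ : 𝔤) (v : V) (w : W),
    T.ρX ξ (T.μ (v ⊗ₜ w)) = T.μ (T.ρV ξ v ⊗ₜ w + v ⊗ₜ T.ρW ξ w)

/-- The action of `U(𝔤) ⊗ U(𝔤)` on `E_R(ρ_V) ⊗ E_R(ρ_W)`. -/
def entireAction (T : GTriple 𝔤 V W X) (N : Seminorm ℝ 𝔤) (R : ℝ≥0) :
    UU 𝔤 →ₗ[ℂ] Module.End ℂ (Entire N T.ρV R ⊗[ℂ] Entire N T.ρW R) :=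
  uuAction (Entire.rep N T.ρV R) (Entire.rep N T.ρW R)

/-- The equicontinuity condition for the formal series `F_ħ = ∑ (ħ^n / n!) F_n`. -/
def EntireEquicontinuous (T : GTriple 𝔤 V W X) (N : Seminorm ℝ 𝔤) (R : ℝ≥0) (F : ℕ → UU 𝔤) :
    Prop :=
  ∀ r : ℝ≥0, 0 < r → ∀ (qV : CS V) (qW : CS W) (K : Set ℂ), IsCompact K →
    ∃ (qV' : CS V) (qW' : CS W) (t : ℝ≥0) (C : ℝ), 0 < t ∧ 0 < C ∧
      ∀ (v : Entire N T.ρV R) (w : Entire N T.ρW R), ∀ ħ ∈ K, ∀ n : ℕ,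
        projSeminorm (Entire.seminorm N T.ρV R r qV) (Entire.seminorm N T.ρW R r qW)
            ((ħ ^ n / (n.factorial : ℂ)) • T.entireAction N R (F n) (v ⊗ₜ w))
          ≤ C * Entire.seminorm N T.ρV R (t * r) qV' v * Entire.seminorm N T.ρW R (t * r) qW' w

end GTriple

end UDF

end

/-! Two estimates carry the proof. The first concerns `μ`. Its continuity gives q(μ(v ⊗ w)) ≤ q_V(v)
q_W(w), and iterating the Leibniz rule bounds the n-fold suprema by a binomial sum. For i + j = n
one has n!^(R-1) C(n,i) = C(n,i)^R (i! j!)^(R-1), and C(n,i) ≤ 2^n. The sum is therefore dominated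
by a Cauchy product: p_{r,q}(μ(v ⊗ w)) ≤ p_{s,q_V}(v) p_{s,q_W}(w) with s = 2^R (r+1)
(`IsMalleable.analyticSeminorm_le`). Hence `μ` restricts to entire vectors.

The second concerns b_n = μ ∘ F_n / n!. Equicontinuity at ħ = ρ gives Cauchy-type bounds ρ^n p(b_n
z) ≤ P(z), uniform in n, for every ρ > 0 (`EntireCoefficients`). Using them at 2ρ leaves a factor
2^(-n), which absorbs polynomial weights, so ∑ ħ^n b_n z and its termwise ħ-derivative converge
absolutely. A quadratic remainder bound, joint in (ħ, z), then gives Fréchet differentiability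
(`differentiable_sum`).

Absolutely convergent series converge in X by sequential completeness. The entire vectors inherit
this because each p_{r,q} is subadditive along convergent sums (`Entire.absSummableComplete`). -/

namespace UDF

open Filter Topology Pointwise

/-! ### Power series of linear maps between seminormed spaces -/

section OperatorSeries

variable {E G : Type*} [AddCommGroup E] [Module ℂ E] [TopologicalSpace E]
  [AddCommGroup G] [Module ℂ G] [TopologicalSpace G]

/-- In a polynormable space, every neighbourhood of zero contains the unit ball of a continuous
seminorm, up to scaling. -/
theorem exists_continuous_seminorm_ball_subset [IsTopologicalAddGroup G] [PolynormableSpace ℂ G] {U : Set G}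
    (hU : U ∈ 𝓝 (0 : G)) :
    ∃ (p : Seminorm ℂ G) (r : ℝ), Continuous p ∧ 0 < r ∧ p.ball 0 r ⊆ U := by
  obtain ⟨⟨s, r⟩, hr, hs⟩ :=
    (PolynormableSpace.withSeminorms ℂ G).hasBasis_zero_ball.mem_iff.1 hU
  exact ⟨_, r, Seminorm.continuous_finsetSup fun p _ => p.2, hr, hs⟩

/-- A second order remainder estimate in terms of continuous seminorms implies Fréchet
differentiability. -/
theorem hasFDerivAt_of_seminorm_le_sq [PolynormableSpace ℂ G] {f : E → G} {f' : E →L[ℂ] G} {x : E}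
    [IsTopologicalAddGroup E] [IsTopologicalAddGroup G]
    (h : ∀ p : Seminorm ℂ G, Continuous p → ∃ s : Seminorm ℂ E, Continuous s ∧
      ∀ᶠ y in 𝓝 x, p (f y - f x - f' (y - x)) ≤ s (y - x) ^ 2) :
    HasFDerivAt f f' x := by
  rw [hasFDerivAt_iff_isLittleOTVS]
  refine ⟨fun U hU => ?_⟩
  obtain ⟨p, r, hp, hr, hpU⟩ := exists_continuous_seminorm_ball_subset hU
  obtain ⟨s, hs, hle⟩ := h p hp
  refine ⟨s.ball 0 1, Seminorm.ball_mem_nhds hs one_pos, fun ε hε => ?_⟩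
  have hε0 : (0 : ℝ) < ε := NNReal.coe_pos.2 (pos_iff_ne_zero.2 hε)
  have hsmall : ∀ᶠ y in 𝓝 x, s (y - x) < ε * r := by
    have : Tendsto (fun y => s (y - x)) (𝓝 x) (𝓝 0) := by
      have h1 : Continuous fun y => s (y - x) := hs.comp (continuous_id.sub continuous_const)
      simpa using h1.tendsto x
    exact this.eventually (gt_mem_nhds (by positivity))
  filter_upwards [hle, hsmall] with y hy hy'
  have hε' : (ε : ℝ≥0∞) ≠ 0 := by simpa using hε
  -- It suffices to test scalars c with s(y - x) < ‖c‖: the remainder has p ≤ s(y - x)² < ε r ‖c‖,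
  -- so it lies in (εc) • U.
  rw [mul_comm, ← ENNReal.div_le_iff hε' ENNReal.coe_ne_top]
  refine le_egauge_of_forall_ne_zero (by simp) fun c hc hcy => ?_
  rw [ENNReal.div_le_iff hε' ENNReal.coe_ne_top]
  rw [Seminorm.smul_ball_zero hc, Seminorm.mem_ball_zero, mul_one] at hcy
  have hce : ((ε : ℝ) : ℂ) * c ≠ 0 := mul_ne_zero (by exact_mod_cast hε0.ne') hc
  have hmem : f y - f x - f' (y - x) ∈ (((ε : ℝ) : ℂ) * c) • U := by
    refine Set.smul_set_mono hpU ?_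
    rw [Seminorm.smul_ball_zero hce, Seminorm.mem_ball_zero, norm_mul, Complex.norm_real,
      Real.norm_of_nonneg hε0.le]
    have h0 := apply_nonneg s (y - x)
    have h2 : ε * r * s (y - x) < ε * r * ‖c‖ := mul_lt_mul_of_pos_left hcy (by positivity)
    nlinarith
  refine (egauge_le_of_mem_smul hmem).trans_eq ?_
  rw [enorm_mul, mul_comm]
  congr 1
  rw [← ofReal_norm, Complex.norm_real, Real.norm_of_nonneg hε0.le,
    ENNReal.ofReal_coe_nnreal]

/-- Assuming 1 ≤ ρ permits the exponent n in place of n - 1, so the induction needs no truncated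
subtraction in the bound. -/
theorem norm_pow_sub_pow_le {a w : ℂ} {ρ : ℝ} (hρ : 1 ≤ ρ) (ha : ‖a‖ ≤ ρ) (hw : ‖w‖ ≤ ρ) (n : ℕ) :
    ‖w ^ n - a ^ n‖ ≤ ‖w - a‖ * (n * ρ ^ n) := by
  induction n with
  | zero => simp
  | succ n ih =>
    have h0 : 0 ≤ ρ := zero_le_one.trans hρ
    have h1 : w ^ (n + 1) - a ^ (n + 1) = w * (w ^ n - a ^ n) + (w - a) * a ^ n := by ring
    have h2 : ‖a‖ ^ n ≤ ρ ^ (n + 1) :=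
      (pow_le_pow_left₀ (norm_nonneg a) ha n).trans (pow_le_pow_right₀ hρ n.le_succ)
    calc ‖w ^ (n + 1) - a ^ (n + 1)‖ ≤ ‖w‖ * ‖w ^ n - a ^ n‖ + ‖w - a‖ * ‖a‖ ^ n := by
          rw [h1, ← norm_pow, ← norm_mul, ← norm_mul]
          exact norm_add_le _ _
      _ ≤ ρ * (‖w - a‖ * (n * ρ ^ n)) + ‖w - a‖ * ρ ^ (n + 1) := by gcongr
      _ = ‖w - a‖ * ((n + 1 : ℕ) * ρ ^ (n + 1)) := by push_cast; ring

theorem norm_pow_sub_pow_sub_deriv_le {a w : ℂ} {ρ : ℝ} (hρ : 1 ≤ ρ) (ha : ‖a‖ ≤ ρ) (hw : ‖w‖ ≤ ρ)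
    (n : ℕ) :
    ‖w ^ n - a ^ n - (w - a) * (n * a ^ (n - 1))‖ ≤ ‖w - a‖ ^ 2 * (n ^ 2 * ρ ^ n) := by
  induction n with
  | zero => simp
  | succ n ih =>
    have h0 : 0 ≤ ρ := zero_le_one.trans hρ
    have h1 : w ^ (n + 1) - a ^ (n + 1) - (w - a) * ((n + 1 : ℕ) * a ^ (n + 1 - 1))
        = a * (w ^ n - a ^ n - (w - a) * (n * a ^ (n - 1))) + (w - a) * (w ^ n - a ^ n) := by
      -- The case n = 0 is separate because `n - 1` truncates there.
      rcases n with _ | n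
      · simp
      · simp only [Nat.add_sub_cancel]; push_cast; ring
    calc _ ≤ ‖a‖ * ‖w ^ n - a ^ n - (w - a) * (n * a ^ (n - 1))‖ + ‖w - a‖ * ‖w ^ n - a ^ n‖ := by
          rw [h1, ← norm_mul, ← norm_mul]
          exact norm_add_le _ _
      _ ≤ ρ * (‖w - a‖ ^ 2 * (n ^ 2 * ρ ^ n)) + ‖w - a‖ * (‖w - a‖ * (n * ρ ^ n)) := by
          gcongr
          exact norm_pow_sub_pow_le hρ ha hw n
      _ = ‖w - a‖ ^ 2 * (n ^ 2 * ρ ^ (n + 1) + n * ρ ^ n) := by ring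
      _ ≤ ‖w - a‖ ^ 2 * (n ^ 2 * ρ ^ (n + 1) + n * ρ ^ (n + 1)) := by
          gcongr
          · exact n.le_succ
      _ ≤ ‖w - a‖ ^ 2 * ((n + 1 : ℕ) ^ 2 * ρ ^ (n + 1)) := by
          have : 0 ≤ ρ ^ (n + 1) := by positivity
          gcongr
          push_cast
          nlinarith [(n.cast_nonneg : (0 : ℝ) ≤ n)]

theorem summable_succ_sq_mul_half_pow : Summable fun n : ℕ => ((n : ℝ) + 1) ^ 2 * (1 / 2) ^ n := by
  have h := (summable_nat_add_iff 1).2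
    (summable_pow_mul_geometric_of_norm_lt_one (R := ℝ) 2 (r := 1 / 2) (by norm_num))
  refine (h.mul_left 2).congr fun n => ?_
  push_cast
  ring

theorem seminorm_le_tsum_of_hasSum {p : Seminorm ℂ G} (hp : Continuous p) {u : ℕ → G} {x : G}
    (hu : HasSum u x) (hs : Summable fun n => p (u n)) : p x ≤ ∑' n, p (u n) :=
  le_of_tendsto ((hp.tendsto x).comp hu) <| Eventually.of_forall fun s =>
    (Finset.le_sum_of_subadditive p (map_zero p).le (map_add_le_add p) s u).trans (hs.sum_le_tsum s fun _ _ => apply_nonneg p _)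

/-- Absolutely convergent series converge. -/
def AbsSummableComplete (G : Type*) [AddCommGroup G] [Module ℂ G] [TopologicalSpace G] : Prop :=
  ∀ u : ℕ → G, (∀ p : Seminorm ℂ G, Continuous p → Summable fun n => p (u n)) → Summable u

/-- The coefficients of an everywhere convergent power series of linear maps, with locally uniform
bounds by continuous seminorms. -/
def EntireCoefficients (b : ℕ → E →ₗ[ℂ] G) : Prop :=
  ∀ p : Seminorm ℂ G, Continuous p → ∀ ρ : ℝ, 0 < ρ → ∃ P : Seminorm ℂ E, Continuous P ∧
    ∀ n z, ρ ^ n * p (b n z) ≤ P z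

namespace EntireCoefficients

variable {b : ℕ → E →ₗ[ℂ] G}

/-- One P serves all scalar sequences of growth (n+1)² ρ^n. The later arguments apply this to
powers, differences of powers, termwise derivatives and second-order Taylor remainders. -/
theorem exists_bound (hb : EntireCoefficients b) {p : Seminorm ℂ G} (hp : Continuous p) {ρ : ℝ}
    (hρ : 0 < ρ) : ∃ P : Seminorm ℂ E, Continuous P ∧
      ∀ (c : ℕ → ℂ) (A : ℝ), (∀ n : ℕ, ‖c n‖ ≤ A * (((n : ℝ) + 1) ^ 2 * ρ ^ n)) → ∀ z,
        (Summable fun n => p (c n • b n z)) ∧ ∑' n, p (c n • b n z) ≤ A * P z := by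
  -- Doubling the radius leaves the summable weight (n+1)² 2^(-n).
  obtain ⟨P, hP, hle⟩ := hb p hp (2 * ρ) (by positivity)
  set M : ℝ := ∑' n : ℕ, ((n : ℝ) + 1) ^ 2 * (1 / 2) ^ n with hM
  have hM0 : 0 ≤ M := tsum_nonneg fun n => by positivity
  let M' : ℝ≥0 := ⟨M, hM0⟩
  refine ⟨M' • P, continuous_const.mul hP, fun c A hc z => ?_⟩
  have hterm : ∀ n : ℕ,
      p (c n • b n z) ≤ (A * P z) * (((n : ℝ) + 1) ^ 2 * (1 / 2) ^ n) := by
    intro n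
    have h1 : ρ ^ n * p (b n z) ≤ (1 / 2) ^ n * P z := by
      have h2 : ρ ^ n = (1 / 2) ^ n * (2 * ρ) ^ n := by rw [← mul_pow]; congr 1; ring
      rw [h2, mul_assoc]
      gcongr
      exact hle n z
    have hA : 0 ≤ A := by
      have h3 := (norm_nonneg _).trans (hc 0)
      simpa using h3
    calc p (c n • b n z) = ‖c n‖ * p (b n z) := map_smul_eq_mul p _ _
      _ ≤ A * (((n : ℝ) + 1) ^ 2 * ρ ^ n) * p (b n z) := by
          gcongr
          exact hc n
      _ = A * ((n : ℝ) + 1) ^ 2 * (ρ ^ n * p (b n z)) := by ring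
      _ ≤ A * ((n : ℝ) + 1) ^ 2 * ((1 / 2) ^ n * P z) := by gcongr
      _ = _ := by ring
  have hsum := summable_succ_sq_mul_half_pow.mul_left (A * P z)
  have hsum' := Summable.of_nonneg_of_le (fun n => apply_nonneg p _) hterm hsum
  refine ⟨hsum', (hsum'.tsum_le_tsum hterm hsum).trans_eq ?_⟩
  rw [tsum_mul_left, ← hM]
  change A * P z * M = A * (M * P z)
  ring

theorem summable (hb : EntireCoefficients b) (hG : AbsSummableComplete G) {ρ : ℝ} (hρ : 0 < ρ)
    {c : ℕ → ℂ} {A : ℝ} (hc : ∀ n : ℕ, ‖c n‖ ≤ A * (((n : ℝ) + 1) ^ 2 * ρ ^ n)) (z : E) :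
    Summable fun n => c n • b n z := by
  refine hG _ fun p hp => ?_
  obtain ⟨P, -, h⟩ := hb.exists_bound hp hρ
  exact (h c A hc z).1

theorem exists_bound_hasSum (hb : EntireCoefficients b) {p : Seminorm ℂ G} (hp : Continuous p)
    {ρ : ℝ} (hρ : 0 < ρ) : ∃ P : Seminorm ℂ E, Continuous P ∧
      ∀ (c : ℕ → ℂ) (A : ℝ), (∀ n : ℕ, ‖c n‖ ≤ A * (((n : ℝ) + 1) ^ 2 * ρ ^ n)) → ∀ z x,
        HasSum (fun n => c n • b n z) x → p x ≤ A * P z := by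
  obtain ⟨P, hP, h⟩ := hb.exists_bound hp hρ
  exact ⟨P, hP, fun c A hc z x hx =>
    (seminorm_le_tsum_of_hasSum hp hx (h c A hc z).1).trans (h c A hc z).2⟩

theorem norm_pow_le_weight {ħ : ℂ} {ρ : ℝ} (h : ‖ħ‖ ≤ ρ) (n : ℕ) :
    ‖ħ ^ n‖ ≤ 1 * (((n : ℝ) + 1) ^ 2 * ρ ^ n) := by
  have h0 : 0 ≤ ρ := (norm_nonneg _).trans h
  rw [norm_pow, one_mul]
  calc ‖ħ‖ ^ n ≤ ρ ^ n := by gcongr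
    _ ≤ ((n : ℝ) + 1) ^ 2 * ρ ^ n :=
        le_mul_of_one_le_left (by positivity) (one_le_pow₀ (by simp))

/-- The sum of a power series of linear maps. -/
theorem exists_sum [T2Space G] [IsTopologicalAddGroup G] [ContinuousSMul ℂ G]
    (hb : EntireCoefficients b) (hG : AbsSummableComplete G) :
    ∃ S : ℂ → E →ₗ[ℂ] G, ∀ ħ z, HasSum (fun n => ħ ^ n • b n z) (S ħ z) := by
  have hs : ∀ (ħ : ℂ) (z : E), Summable fun n => ħ ^ n • b n z := fun ħ z =>
    hb.summable hG (ρ := ‖ħ‖ + 1) (by positivity) (norm_pow_le_weight (by simp)) z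
  refine ⟨fun ħ =>
    { toFun := fun z => ∑' n, ħ ^ n • b n z
      map_add' := fun z z' => ?_
      map_smul' := fun c z => ?_ }, fun ħ z => (hs ħ z).hasSum⟩
  · refine HasSum.tsum_eq ?_
    simpa only [map_add, smul_add] using (hs ħ z).hasSum.add (hs ħ z').hasSum
  · refine HasSum.tsum_eq ?_
    simpa only [map_smul, smul_comm _ c, RingHom.id_apply] using (hs ħ z).hasSum.const_smul c

variable {S : ℂ → E →ₗ[ℂ] G}

theorem continuous_sum [IsTopologicalAddGroup E] [IsTopologicalAddGroup G] [PolynormableSpace ℂ G]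
    (hb : EntireCoefficients b)
    (hS : ∀ ħ z, HasSum (fun n => ħ ^ n • b n z) (S ħ z)) (ħ : ℂ) : Continuous (S ħ) := by
  refine WithSeminorms.continuous_of_continuous_comp (PolynormableSpace.withSeminorms ℂ G) _ ?_
  rintro ⟨p, hp⟩
  obtain ⟨P, hP, h⟩ := hb.exists_bound_hasSum hp (ρ := ‖ħ‖ + 1) (by positivity)
  refine Seminorm.continuous_of_le hP fun z => ?_
  simpa using h _ _ (norm_pow_le_weight (by simp)) z _ (hS ħ z)

theorem differentiable_sum [IsTopologicalAddGroup E] [ContinuousSMul ℂ E]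
    [IsTopologicalAddGroup G] [ContinuousSMul ℂ G] [PolynormableSpace ℂ G]
    (hb : EntireCoefficients b) (hG : AbsSummableComplete G)
    (hS : ∀ ħ z, HasSum (fun n => ħ ^ n • b n z) (S ħ z)) :
    Differentiable ℂ fun x : ℂ × E => S x.1 x.2 := by
  rintro ⟨a, z₀⟩
  set ρ : ℝ := ‖a‖ + 1 with hρdef
  have hρ : 1 ≤ ρ := by simp [hρdef]
  have hρ0 : 0 < ρ := one_pos.trans_le hρ
  have haρ : ‖a‖ ≤ ρ := by simp [hρdef]
  have hder : ∀ n : ℕ, ‖(n : ℂ) * a ^ (n - 1)‖ ≤ 1 * (((n : ℝ) + 1) ^ 2 * ρ ^ n) := by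
    intro n
    rw [norm_mul, norm_pow, one_mul, Complex.norm_natCast]
    have h1 : ‖a‖ ^ (n - 1) ≤ ρ ^ n :=
      (pow_le_pow_left₀ (norm_nonneg a) haρ _).trans (pow_le_pow_right₀ hρ (n.sub_le 1))
    gcongr
    nlinarith [(n.cast_nonneg : (0 : ℝ) ≤ n)]
  -- g is the partial derivative in ħ at (a, z₀); the partial derivative in z is S a itself, by
  -- linearity.
  obtain ⟨g, hg⟩ := hb.summable hG hρ0 hder z₀
  let D : ℂ × E →L[ℂ] G :=
    ((ContinuousLinearMap.id ℂ ℂ).smulRight g).comp (ContinuousLinearMap.fst ℂ ℂ E) +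
      (⟨S a, hb.continuous_sum hS a⟩ : E →L[ℂ] G).comp (ContinuousLinearMap.snd ℂ ℂ E)
  refine ⟨D, hasFDerivAt_of_seminorm_le_sq fun p hp => ?_⟩
  obtain ⟨P, hP, hbd⟩ := hb.exists_bound_hasSum hp hρ0
  -- The factor 1 + P z₀ makes αβ + α² P z₀ at most the square of (1 + P z₀)(α + β), where α = ‖w -
  -- a‖ and β = P (z - z₀).
  let M : ℝ≥0 := ⟨1 + P z₀, by have := apply_nonneg P z₀; positivity⟩
  let s : Seminorm ℂ (ℂ × E) :=
    M •
      ((normSeminorm ℂ ℂ).comp (LinearMap.fst ℂ ℂ E) + P.comp (LinearMap.snd ℂ ℂ E))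
  have hs : ∀ x : ℂ × E, s x = (1 + P z₀) * (‖x.1‖ + P x.2) := fun _ => rfl
  refine ⟨s, ?_, ?_⟩
  · change Continuous fun x : ℂ × E => (1 + P z₀) * (‖x.1‖ + P x.2)
    exact continuous_const.mul ((continuous_norm.comp continuous_fst).add (hP.comp continuous_snd))
  · have hnear : ∀ᶠ x : ℂ × E in 𝓝 (a, z₀), ‖x.1‖ < ρ :=
      (continuous_norm.comp continuous_fst).continuousAt.eventually
        (gt_mem_nhds (by simp [hρdef]))
    filter_upwards [hnear] with x hx
    obtain ⟨w, z⟩ := x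
    have hw : ‖w‖ ≤ ρ := hx.le
    have h1 : p (S w (z - z₀) - S a (z - z₀)) ≤ ‖w - a‖ * P (z - z₀) := by
      refine hbd (fun n => w ^ n - a ^ n) _ (fun n => ?_) (z - z₀) _ ?_
      · refine (norm_pow_sub_pow_le hρ haρ hw n).trans ?_
        gcongr
        nlinarith [(n.cast_nonneg : (0 : ℝ) ≤ n)]
      · simpa only [sub_smul] using (hS w (z - z₀)).sub (hS a (z - z₀))
    have h2 : p (S w z₀ - S a z₀ - (w - a) • g) ≤ ‖w - a‖ ^ 2 * P z₀ := by
      refine hbd (fun n => w ^ n - a ^ n - (w - a) * (n * a ^ (n - 1))) _ (fun n => ?_) z₀ _ ?_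
      · refine (norm_pow_sub_pow_sub_deriv_le hρ haρ hw n).trans ?_
        gcongr
        simp
      · simpa only [sub_smul, mul_smul] using
          ((hS w z₀).sub (hS a z₀)).sub (hg.const_smul (w - a))
    -- The mixed term is first order in each of ħ and z; the other is the one-variable Taylor
    -- remainder at z₀.
    have hrem : S w z - S a z₀ - D ((w, z) - (a, z₀))
        = (S w (z - z₀) - S a (z - z₀)) + (S w z₀ - S a z₀ - (w - a) • g) := by
      have : D ((w, z) - (a, z₀)) = (w - a) • g + S a (z - z₀) := rfl
      rw [this, map_sub, map_sub]
      abel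
    change p (S w z - S a z₀ - D ((w, z) - (a, z₀))) ≤ s ((w, z) - (a, z₀)) ^ 2
    rw [hrem, hs]
    refine (map_add_le_add p _ _).trans ((add_le_add h1 h2).trans ?_)
    change _ ≤ ((1 + P z₀) * (‖w - a‖ + P (z - z₀))) ^ 2
    have e1 := norm_nonneg (w - a)
    have e2 := apply_nonneg P (z - z₀)
    have e3 := apply_nonneg P z₀
    generalize ‖w - a‖ = α at *
    generalize P (z - z₀) = β at *
    generalize P z₀ = γ at *
    rw [mul_pow]
    calc α * β + α ^ 2 * γ ≤ (1 + γ) * (α + β) ^ 2 := by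
          nlinarith [mul_nonneg e1 e2, mul_nonneg e3 (mul_nonneg e1 e2), mul_nonneg e3 (sq_nonneg β),
            sq_nonneg α, sq_nonneg β]
      _ ≤ (1 + γ) ^ 2 * (α + β) ^ 2 := by
          gcongr
          nlinarith

end EntireCoefficients

end OperatorSeries

/-! ### Convergence of absolutely convergent series in X -/

theorem polynormableSpace_of_locallyConvexSpace_real (X : Type*) [AddCommGroup X] [Module ℂ X]
    [TopologicalSpace X] [IsTopologicalAddGroup X] [ContinuousSMul ℂ X] [LocallyConvexSpace ℝ X] :
    PolynormableSpace ℂ X := by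
  open ComplexOrder in
  have : LocallyConvexSpace ℂ X := by
    refine LocallyConvexSpace.mk fun x => ?_
    have h := LocallyConvexSpace.convex_basis (𝕜 := ℝ) x
    simpa only [convex_RCLike_iff_convex_real] using h
  have : ContinuousSMul ℝ X := IsScalarTower.continuousSMul ℂ
  exact LocallyConvexSpace.toPolynormableSpace

/-- The net of all finite partial sums is Cauchy. Sequential completeness only provides a limit
along initial segments, but these are cofinal, and a Cauchy net converges to such a limit. -/
theorem SeqComplete.absSummableComplete {X : Type*} [AddCommGroup X] [Module ℂ X]
    [TopologicalSpace X] [IsTopologicalAddGroup X] [PolynormableSpace ℂ X] (hX : SeqComplete X) :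
    AbsSummableComplete X := by
  intro u hu
  let _ : UniformSpace X := IsTopologicalAddGroup.rightUniformSpace X
  have : IsUniformAddGroup X := isUniformAddGroup_of_addCommGroup
  have hcau : CauchySeq fun s : Finset ℕ => ∑ n ∈ s, u n := by
    rw [cauchySeq_finset_iff_sum_vanishing]
    intro e he
    obtain ⟨p, r, hp, hr, hpe⟩ := exists_continuous_seminorm_ball_subset he
    obtain ⟨s, hs⟩ := summable_iff_vanishing.1 (hu p hp) _ (gt_mem_nhds hr)
    refine ⟨s, fun t ht => hpe ?_⟩
    rw [Seminorm.mem_ball_zero]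
    exact (Finset.le_sum_of_subadditive p (map_zero p).le (map_add_le_add p) t u).trans_lt (hs t ht)
  have hrange : CauchySeq fun n => ∑ i ∈ Finset.range n, u i :=
    hcau.comp_tendsto tendsto_finset_range
  obtain ⟨x, hx⟩ := hX (fun n => ∑ i ∈ Finset.range n, u i) (by
    have h := hrange.tendsto_uniformity
    rw [uniformity_eq_comap_nhds_zero_swapped] at h
    exact tendsto_comap_iff.1 h)
  exact ⟨x, tendsto_nhds_of_cauchySeq_of_subseq hcau tendsto_finset_range hx⟩

/-! ### Convergence of absolutely convergent series of entire vectors -/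

section EntireCompleteness

variable {𝔤 : Type*} [LieRing 𝔤] [LieAlgebra ℝ 𝔤]
variable {V : Type*} [AddCommGroup V] [Module ℂ V] [TopologicalSpace V]
  [IsTopologicalAddGroup V] [ContinuousSMul ℂ V]
variable (N : Seminorm ℝ 𝔤) (ρ : 𝔤 →ₗ⁅ℝ⁆ (V →L[ℂ] V)) (R : ℝ≥0)

/-- For fixed ξ's, v ↦ q(ξ₁⋯ξ_n ▹ v) is continuous, so finite subadditivity passes to the limit
before the supremum is taken. -/
theorem supTerm_le_tsum_of_hasSum {q : Seminorm ℂ V} (hq : Continuous q) (n : ℕ) {ι : Type*}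
    {u : ι → V} {x : V} (hu : HasSum u x) : supTerm N ρ q n x ≤ ∑' i, supTerm N ρ q n (u i) := by
  refine iSup₂_le fun ξ hξ => ?_
  set L : V →L[ℂ] V := (List.ofFn fun i => ρ (ξ i)).prod with hL
  have hle : ∀ v, ENNReal.ofReal (q (L v)) ≤ supTerm N ρ q n v := fun v =>
    le_iSup₂ (f := fun (ξ : Fin n → 𝔤) (_ : ∀ i, N (ξ i) < 1) =>
      ENNReal.ofReal (q ((List.ofFn fun i => ρ (ξ i)).prod v))) ξ hξ
  have hcont : Continuous fun v => ENNReal.ofReal (q (L v)) :=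
    ENNReal.continuous_ofReal.comp (hq.comp L.continuous)
  refine le_of_tendsto ((hcont.tendsto x).comp hu) (Eventually.of_forall fun s => ?_)
  calc ENNReal.ofReal (q (L (∑ i ∈ s, u i)))
      ≤ ∑ i ∈ s, ENNReal.ofReal (q (L (u i))) := by
        rw [map_sum, ← ENNReal.ofReal_sum_of_nonneg fun i _ => apply_nonneg q _]
        exact ENNReal.ofReal_le_ofReal
          (Finset.le_sum_of_subadditive q (map_zero q).le (map_add_le_add q) s _)
    _ ≤ ∑ i ∈ s, supTerm N ρ q n (u i) := Finset.sum_le_sum fun i _ => hle _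
    _ ≤ ∑' i, supTerm N ρ q n (u i) := ENNReal.sum_le_tsum s

theorem analyticSeminorm_le_tsum_of_hasSum {q : Seminorm ℂ V} (hq : Continuous q) (r : ℝ≥0)
    {ι : Type*} {u : ι → V} {x : V} (hu : HasSum u x) :
    analyticSeminorm N ρ R r q x ≤ ∑' i, analyticSeminorm N ρ R r q (u i) := by
  unfold analyticSeminorm
  rw [ENNReal.tsum_comm]
  refine ENNReal.tsum_le_tsum fun n => ?_
  rw [ENNReal.tsum_mul_left]
  gcongr
  exact supTerm_le_tsum_of_hasSum N ρ hq n hu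

/-- The n = 0 summand is q v, since 0!^(R-1) r^0 = 1 even for r = 0. So the topology on entire
vectors is finer than that of V. -/
theorem le_analyticSeminorm (r : ℝ≥0) (q : Seminorm ℂ V) (v : V) :
    ENNReal.ofReal (q v) ≤ analyticSeminorm N ρ R r q v := by
  refine le_trans ?_ (ENNReal.le_tsum 0)
  simp [coeffTerm, supTerm]

namespace Entire

instance instPolynormableSpace : PolynormableSpace ℂ (Entire N ρ R) :=
  (withSeminorms N ρ R).toPolynormableSpace

theorem le_seminorm (r : ℝ≥0) (q : CS V) (v : Entire N ρ R) :
    q.1 (incl N ρ R v) ≤ seminorm N ρ R r q v :=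
  (ENNReal.ofReal_le_iff_le_toReal (incl_lt_top N ρ R q r v).ne).1
    (le_analyticSeminorm N ρ R r q.1 _)

theorem continuous_seminorm (r : ℝ≥0) (q : CS V) : Continuous (seminorm N ρ R r q) :=
  (withSeminorms N ρ R).continuous_seminorm (r, q)

theorem incl_injective : Function.Injective (incl N ρ R) :=
  Subtype.val_injective

theorem continuous_incl [PolynormableSpace ℂ V] : Continuous (incl N ρ R) :=
  WithSeminorms.continuous_of_continuous_comp (PolynormableSpace.withSeminorms ℂ V) _ fun q =>
    Seminorm.continuous_of_le (continuous_seminorm N ρ R 0 q) (le_seminorm N ρ R 0 q)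

theorem t2Space [PolynormableSpace ℂ V] [T2Space V] : T2Space (Entire N ρ R) :=
  T2Space.of_injective_continuous (incl_injective N ρ R) (continuous_incl N ρ R)

/-- The sum is formed in V. Subadditivity along convergent sums shows that it is entire, and,
applied to tails, that the series converges in the finer topology. -/
theorem absSummableComplete (hV : AbsSummableComplete V) :
    AbsSummableComplete (Entire N ρ R) := by
  intro u hu
  have hfin : ∀ (r : ℝ≥0) (q : CS V),
      ∑' n, analyticSeminorm N ρ R r q.1 (incl N ρ R (u n)) ≠ ∞ := by
    intro r q
    have h := (hu _ (continuous_seminorm N ρ R r q)).tsum_ofReal_ne_top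
    simpa only [seminorm_apply, ENNReal.ofReal_toReal (incl_lt_top N ρ R q r _).ne] using h
  obtain ⟨x, hx⟩ := hV (fun n => incl N ρ R (u n)) fun q hq =>
    Summable.of_nonneg_of_le (fun n => apply_nonneg q _)
      (fun n => le_seminorm N ρ R 0 ⟨q, hq⟩ (u n)) (hu _ (continuous_seminorm N ρ R 0 ⟨q, hq⟩))
  have hmem : x ∈ entireVectors N ρ R := mem_entireVectors.2 fun q r =>
    (analyticSeminorm_le_tsum_of_hasSum N ρ R q.2 r hx).trans_lt (hfin r q).lt_top
  let y : Entire N ρ R := ⟨x, hmem⟩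
  refine ⟨y, ((withSeminorms N ρ R).tendsto_nhds _ _).2 ?_⟩
  rintro ⟨r, q⟩ ε hε
  filter_upwards [(ENNReal.tendsto_tsum_compl_atTop_zero (hfin r q)).eventually
    (gt_mem_nhds (ENNReal.ofReal_pos.2 hε))] with s hs
  have hsum : HasSum (fun n : {n // n ∉ s} => incl N ρ R (u n))
      (incl N ρ R (y - ∑ n ∈ s, u n)) := by
    refine (Finset.hasSum_compl_iff (f := fun n => incl N ρ R (u n)) s).2 ?_
    rw [map_sub, map_sum, sub_add_cancel]
    exact hx
  change seminorm N ρ R r q _ < ε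
  rw [map_sub_rev, seminorm_apply]
  exact (ENNReal.lt_ofReal_iff_toReal_lt (incl_lt_top N ρ R q r _).ne).1
    ((analyticSeminorm_le_tsum_of_hasSum N ρ R q.2 r hsum).trans_lt hs)

end Entire

end EntireCompleteness

/-! ### Projective seminorms and reduction to elementary tensors -/

section ProjectiveTopology

theorem projSeminorm_tmul_le {V W : Type*} [AddCommGroup V] [Module ℂ V] [AddCommGroup W]
    [Module ℂ W] (p : Seminorm ℂ V) (q : Seminorm ℂ W) (v : V) (w : W) :
    projSeminorm p q (v ⊗ₜ w) ≤ p v * q w := by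
  simpa [tensorOfList, costOfList] using! projFun_le p q [(v, w)]

/-- p ⊗ q is the largest seminorm with this bound on elementary tensors, so later estimates need
checking only there. -/
theorem le_projSeminorm {V W : Type*} [AddCommGroup V] [Module ℂ V] [AddCommGroup W]
    [Module ℂ W] {p : Seminorm ℂ V} {q : Seminorm ℂ W} {Q : Seminorm ℂ (V ⊗[ℂ] W)}
    (h : ∀ v w, Q (v ⊗ₜ w) ≤ p v * q w) : Q ≤ projSeminorm p q := by
  intro z
  obtain ⟨l₀, hl₀⟩ := tensorOfList_surjective z
  have : Nonempty {l : List (V × W) // tensorOfList l = z} := ⟨⟨l₀, hl₀⟩⟩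
  rw [projSeminorm_apply]
  refine le_ciInf ?_
  rintro ⟨l, rfl⟩
  clear hl₀ this
  simp only [tensorOfList, costOfList]
  induction l with
  | nil => simp
  | cons x l ih =>
    simp only [List.map_cons, List.sum_cons]
    exact (map_add_le_add Q _ _).trans (add_le_add (h _ _) ih)

variable (V W : Type*) [AddCommGroup V] [Module ℂ V] [TopologicalSpace V]
  [AddCommGroup W] [Module ℂ W] [TopologicalSpace W]

theorem projFamily_withSeminorms : WithSeminorms (projFamily V W) := ⟨rfl⟩

instance projTopology_isTopologicalAddGroup : IsTopologicalAddGroup (V ⊗[ℂ] W) :=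
  (projFamily_withSeminorms V W).topologicalAddGroup

instance projTopology_continuousSMul : ContinuousSMul ℂ (V ⊗[ℂ] W) :=
  (projFamily_withSeminorms V W).continuousSMul

variable {V W}

theorem continuous_projSeminorm {p : Seminorm ℂ V} {q : Seminorm ℂ W} (hp : Continuous p)
    (hq : Continuous q) : Continuous (projSeminorm p q) :=
  (projFamily_withSeminorms V W).continuous_seminorm (⟨p, hp⟩, ⟨q, hq⟩)

theorem exists_tmul_le_of_continuous [IsTopologicalAddGroup V] [IsTopologicalAddGroup W]
    {Q : Seminorm ℂ (V ⊗[ℂ] W)} (hQ : Continuous Q) :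
    ∃ (p : CS V) (q : CS W), ∀ v w, Q (v ⊗ₜ w) ≤ p.1 v * q.1 w := by
  obtain ⟨s, C, -, hle⟩ := Seminorm.bound_of_continuous (projFamily_withSeminorms V W) Q hQ
  -- A finite supremum of products is at most the product of the suprema; the constant C goes into
  -- the first factor.
  refine ⟨⟨C • s.sup fun i => i.1.1,
      continuous_const.mul (Seminorm.continuous_finsetSup fun i _ => i.1.2)⟩,
    ⟨s.sup fun i => i.2.1, Seminorm.continuous_finsetSup fun i _ => i.2.2⟩, fun v w => ?_⟩
  refine (hle _).trans ?_
  change C * (s.sup (projFamily V W)) (v ⊗ₜ w)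
    ≤ C * (s.sup fun i : CS V × CS W => i.1.1) v * (s.sup fun i : CS V × CS W => i.2.1) w
  rw [mul_assoc]
  refine mul_le_mul_of_nonneg_left ?_ C.2
  refine Seminorm.finset_sup_apply_le (mul_nonneg (apply_nonneg _ _) (apply_nonneg _ _))
    fun i hi => (projSeminorm_tmul_le _ _ v w).trans ?_
  exact mul_le_mul (Seminorm.le_finset_sup_apply (p := fun i : CS V × CS W => i.1.1) hi)
    (Seminorm.le_finset_sup_apply (p := fun i : CS V × CS W => i.2.1) hi)
    (apply_nonneg _ _) (apply_nonneg _ _)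

end ProjectiveTopology

theorem EntireCoefficients.of_withSeminorms {E G ι : Type*} [AddCommGroup E] [Module ℂ E]
    [TopologicalSpace E] [IsTopologicalAddGroup E] [AddCommGroup G] [Module ℂ G]
    [TopologicalSpace G] {fam : SeminormFamily ℂ G ι} (hfam : WithSeminorms fam)
    {b : ℕ → E →ₗ[ℂ] G}
    (h : ∀ i, ∀ ρ : ℝ, 0 < ρ → ∃ P : Seminorm ℂ E, Continuous P ∧
      ∀ n z, ρ ^ n * fam i (b n z) ≤ P z) : EntireCoefficients b := by
  intro p hp ρ hρ
  obtain ⟨s, C, -, hle⟩ := Seminorm.bound_of_continuous hfam p hp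
  choose P hP hbd using fun i => h i ρ hρ
  refine ⟨C • s.sup P, continuous_const.mul (Seminorm.continuous_finsetSup fun i _ => hP i),
    fun n z => ?_⟩
  have hsup : s.sup fam (b n z) ≤ (s.sup P) z / ρ ^ n :=
    Seminorm.finset_sup_apply_le (div_nonneg (apply_nonneg _ _) (by positivity)) fun i hi => by
      rw [le_div_iff₀' (by positivity)]
      exact (hbd i n z).trans (Seminorm.le_finset_sup_apply hi)
  calc ρ ^ n * p (b n z) ≤ ρ ^ n * (C * s.sup fam (b n z)) := by
        gcongr
        exact hle _
    _ ≤ ρ ^ n * (C * ((s.sup P) z / ρ ^ n)) := by gcongr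
    _ = C * (s.sup P) z := by field_simp

/-! ### The Leibniz estimate for the order-R weights -/

section Leibniz

/-- The weights combine to C(n,i)^R (i! j!)^(R-1) r^n, and C(n,i)^R ≤ (2^R)^n. Using r + 1 instead
of r keeps the new radius positive, as the equicontinuity condition demands. -/
theorem coeffTerm_mul_choose_le (R r : ℝ≥0) {n : ℕ} {ij : ℕ × ℕ}
    (h : ij ∈ Finset.HasAntidiagonal.antidiagonal n) :
    coeffTerm R r n * (n.choose ij.1 : ℝ≥0)
      ≤ coeffTerm R (2 ^ (R : ℝ) * (r + 1)) ij.1 * coeffTerm R (2 ^ (R : ℝ) * (r + 1)) ij.2 := by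
  obtain ⟨i, j⟩ := ij
  obtain rfl : i + j = n := Finset.HasAntidiagonal.mem_antidiagonal.1 h
  have hfac : ((i + j).factorial : ℝ≥0) = (i + j).choose i * (i.factorial * j.factorial) := by
    rw [Nat.choose_symm_add]
    exact_mod_cast ((Nat.add_choose_mul_factorial_mul_factorial i j).symm.trans (mul_assoc _ _ _))
  have hC : (0 : ℝ≥0) < (i + j).choose i := by exact_mod_cast Nat.choose_pos (Nat.le_add_right i j)
  have hCle : ((i + j).choose i : ℝ≥0) ≤ 2 ^ (i + j) := by
    exact_mod_cast Nat.choose_le_two_pow (i + j) i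
  have hCR : ((i + j).choose i : ℝ≥0) ^ ((R : ℝ) - 1) * (i + j).choose i ≤ (2 ^ (R : ℝ)) ^ (i + j) := by
    calc ((i + j).choose i : ℝ≥0) ^ ((R : ℝ) - 1) * (i + j).choose i
        = ((i + j).choose i : ℝ≥0) ^ (R : ℝ) := by
          conv_lhs => enter [2]; rw [← NNReal.rpow_one ((i + j).choose i : ℝ≥0)]
          rw [← NNReal.rpow_add hC.ne', sub_add_cancel]
      _ ≤ (2 ^ (i + j)) ^ (R : ℝ) := NNReal.rpow_le_rpow hCle R.2
      _ = (2 ^ (R : ℝ)) ^ (i + j) := by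
          rw [← NNReal.rpow_natCast, ← NNReal.rpow_natCast, ← NNReal.rpow_mul, ← NNReal.rpow_mul,
            mul_comm]
  unfold coeffTerm
  rw [hfac, NNReal.mul_rpow, NNReal.mul_rpow]
  calc _ = (((i + j).choose i : ℝ≥0) ^ ((R : ℝ) - 1) * (i + j).choose i) * r ^ (i + j) *
          ((i.factorial : ℝ≥0) ^ ((R : ℝ) - 1) * (j.factorial : ℝ≥0) ^ ((R : ℝ) - 1)) := by ring
    _ ≤ (2 ^ (R : ℝ)) ^ (i + j) * (r + 1) ^ (i + j) *
          ((i.factorial : ℝ≥0) ^ ((R : ℝ) - 1) * (j.factorial : ℝ≥0) ^ ((R : ℝ) - 1)) := by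
        gcongr
        exact le_self_add
    _ = _ := by rw [mul_pow, mul_pow]; ring

variable {𝔤 : Type*} [LieRing 𝔤] [LieAlgebra ℝ 𝔤]

section

variable {V : Type*} [AddCommGroup V] [Module ℂ V] [TopologicalSpace V]
  [IsTopologicalAddGroup V] [ContinuousSMul ℂ V]
  (N : Seminorm ℝ 𝔤) (ρ : 𝔤 →ₗ⁅ℝ⁆ (V →L[ℂ] V)) (q : Seminorm ℂ V) (n : ℕ)

theorem supTerm_zero_left (v : V) : supTerm N ρ q 0 v = ENNReal.ofReal (q v) := by
  simp [supTerm]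

/-- As ξ is already in the unit ball, no scaling factor appears, unlike in `supTerm_rep_le`.
Together with `supTerm_succ_le` this peels off the operator that acts first, which drives the
Leibniz induction. -/
theorem supTerm_rep_le_succ {ξ : 𝔤} (hξ : N ξ < 1) (v : V) :
    supTerm N ρ q n (ρ ξ v) ≤ supTerm N ρ q (n + 1) v := by
  refine iSup₂_le fun η hη => ?_
  have hball : ∀ i, N ((Fin.snoc η ξ : Fin (n + 1) → 𝔤) i) < 1 := fun i =>
    Fin.lastCases (by simpa using hξ) (fun j => by simpa using hη j) i
  refine le_trans (le_of_eq ?_) (le_iSup₂ (f := fun (ξ : Fin (n + 1) → 𝔤) (_ : ∀ i, N (ξ i) < 1) =>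
      ENNReal.ofReal (q ((List.ofFn fun i => ρ (ξ i)).prod v))) _ hball)
  rw [List.ofFn_succ_last]
  simp

theorem supTerm_succ_le {v : V} {B : ℝ≥0∞} (h : ∀ ξ, N ξ < 1 → supTerm N ρ q n (ρ ξ v) ≤ B) :
    supTerm N ρ q (n + 1) v ≤ B := by
  refine iSup₂_le fun η hη => le_trans ?_ (h (η (Fin.last n)) (hη _))
  refine le_trans (le_of_eq ?_) (le_iSup₂ (f := fun (ξ : Fin n → 𝔤) (_ : ∀ i, N (ξ i) < 1) =>
      ENNReal.ofReal (q ((List.ofFn fun i => ρ (ξ i)).prod (ρ (η (Fin.last n)) v))))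
    (fun i => η i.castSucc) fun i => hη _)
  rw [List.ofFn_succ_last]
  simp

end

variable {V : Type*} [AddCommGroup V] [Module ℂ V] [TopologicalSpace V]
  [IsTopologicalAddGroup V] [ContinuousSMul ℂ V] [LocallyConvexSpace ℝ V]
variable {W : Type*} [AddCommGroup W] [Module ℂ W] [TopologicalSpace W]
  [IsTopologicalAddGroup W] [ContinuousSMul ℂ W] [LocallyConvexSpace ℝ W]
variable {X : Type*} [AddCommGroup X] [Module ℂ X] [TopologicalSpace X]
  [IsTopologicalAddGroup X] [ContinuousSMul ℂ X] [LocallyConvexSpace ℝ X]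

namespace GTriple

variable {T : GTriple 𝔤 V W X} {N : Seminorm ℝ 𝔤} {q : Seminorm ℂ X} {qV : Seminorm ℂ V}
  {qW : Seminorm ℂ W}

/-- Induction on n: the Leibniz rule splits the innermost operator into two terms, recombined by
Pascal's rule. -/
theorem IsMalleable.supTerm_le (hT : T.IsMalleable)
    (hq : ∀ v w, q (T.μ (v ⊗ₜ w)) ≤ qV v * qW w) (n : ℕ) (v : V) (w : W) :
    supTerm N T.ρX q n (T.μ (v ⊗ₜ w)) ≤ ∑ ij ∈ Finset.HasAntidiagonal.antidiagonal n,
      (n.choose ij.1 : ℝ≥0∞) * (supTerm N T.ρV qV ij.1 v * supTerm N T.ρW qW ij.2 w) := by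
  induction n generalizing v w with
  | zero =>
    simp only [Finset.Nat.antidiagonal_zero, Finset.sum_singleton, supTerm_zero_left,
      Nat.choose_self, Nat.cast_one, one_mul]
    rw [← ENNReal.ofReal_mul (apply_nonneg qV v)]
    exact ENNReal.ofReal_le_ofReal (hq v w)
  | succ n ih =>
    refine supTerm_succ_le N T.ρX q n fun ξ hξ => ?_
    rw [hT, map_add, Finset.sum_antidiagonal_choose_succ_mul fun i j =>
      supTerm N T.ρV qV i v * supTerm N T.ρW qW j w, add_comm (Finset.sum _ _)]
    refine (supTerm_add_le N T.ρX q n _ _).trans (add_le_add ?_ ?_)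
    · refine (ih _ _).trans (Finset.sum_le_sum fun ij hij => ?_)
      rw [Nat.choose_symm_of_eq_add (Finset.HasAntidiagonal.mem_antidiagonal.1 hij).symm]
      gcongr
      exact supTerm_rep_le_succ N T.ρV qV _ hξ v
    · refine (ih _ _).trans (Finset.sum_le_sum fun ij _ => ?_)
      gcongr
      exact supTerm_rep_le_succ N T.ρW qW _ hξ w

theorem IsMalleable.analyticSeminorm_le (hT : T.IsMalleable)
    (hq : ∀ v w, q (T.μ (v ⊗ₜ w)) ≤ qV v * qW w) (R r : ℝ≥0) (v : V) (w : W) :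
    analyticSeminorm N T.ρX R r q (T.μ (v ⊗ₜ w))
      ≤ analyticSeminorm N T.ρV R (2 ^ (R : ℝ) * (r + 1)) qV v *
        analyticSeminorm N T.ρW R (2 ^ (R : ℝ) * (r + 1)) qW w := by
  set s : ℝ≥0 := 2 ^ (R : ℝ) * (r + 1)
  set f : ℕ × ℕ → ℝ≥0∞ := fun ij =>
    ((coeffTerm R s ij.1 : ℝ≥0∞) * supTerm N T.ρV qV ij.1 v) *
      ((coeffTerm R s ij.2 : ℝ≥0∞) * supTerm N T.ρW qW ij.2 w) with hf
  calc analyticSeminorm N T.ρX R r q (T.μ (v ⊗ₜ w))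
      ≤ ∑' n, ∑ ij ∈ Finset.HasAntidiagonal.antidiagonal n, f ij := by
        refine ENNReal.tsum_le_tsum fun n => ?_
        refine (mul_le_mul_right (hT.supTerm_le hq n v w) _).trans ?_
        rw [Finset.mul_sum]
        refine Finset.sum_le_sum fun ij hij => ?_
        have hc : (coeffTerm R r n : ℝ≥0∞) * (n.choose ij.1 : ℝ≥0∞)
            ≤ (coeffTerm R s ij.1 : ℝ≥0∞) * (coeffTerm R s ij.2 : ℝ≥0∞) := by
          exact_mod_cast coeffTerm_mul_choose_le R r hij
        rw [← mul_assoc, hf]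
        refine (mul_le_mul_left hc _).trans_eq ?_
        ring
    -- Regrouping along antidiagonals is unconditional in `ℝ≥0∞`.
    _ = ∑' ij : ℕ × ℕ, f ij := by
        rw [← Finset.HasAntidiagonal.sigmaAntidiagonalEquivProd.tsum_eq f, ENNReal.tsum_sigma']
        refine tsum_congr fun n => ?_
        rw [← Finset.tsum_subtype]
        rfl
    _ = _ := by
        rw [ENNReal.tsum_prod']
        simp only [hf, ENNReal.tsum_mul_left, ENNReal.tsum_mul_right]
        rfl

/-! ### The induced product and the coefficients of the deformed product -/

theorem exists_seminorm_mu_le (hcont : T.IsContinuous) (q : CS X) :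
    ∃ (qV : CS V) (qW : CS W), ∀ v w, q.1 (T.μ (v ⊗ₜ w)) ≤ qV.1 v * qW.1 w :=
  exists_tmul_le_of_continuous (Q := q.1.comp T.μ) (q.2.comp hcont)

theorem mu_incl_mem_entireVectors (hcont : T.IsContinuous) (hT : T.IsMalleable)
    (N : Seminorm ℝ 𝔤) (R : ℝ≥0) (z : Entire N T.ρV R ⊗[ℂ] Entire N T.ρW R) :
    T.μ (TensorProduct.map (Entire.incl N T.ρV R) (Entire.incl N T.ρW R) z)
      ∈ entireVectors N T.ρX R := by
  induction z using TensorProduct.induction_on with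
  | zero => simp
  | tmul v w =>
    refine mem_entireVectors.2 fun q r => ?_
    obtain ⟨qV, qW, hq⟩ := exists_seminorm_mu_le hcont q
    exact (hT.analyticSeminorm_le hq R r _ _).trans_lt
      (ENNReal.mul_lt_top (Entire.incl_lt_top N T.ρV R qV _ v)
        (Entire.incl_lt_top N T.ρW R qW _ w))
  | add x y hx hy =>
    rw [map_add, map_add]
    exact add_mem hx hy

/-- The map induced by `μ` on entire vectors. -/
noncomputable def entireMu (hcont : T.IsContinuous) (hT : T.IsMalleable) (N : Seminorm ℝ 𝔤)
    (R : ℝ≥0) : Entire N T.ρV R ⊗[ℂ] Entire N T.ρW R →ₗ[ℂ] Entire N T.ρX R :=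
  LinearMap.codRestrict (entireVectors N T.ρX R)
    (T.μ ∘ₗ TensorProduct.map (Entire.incl N T.ρV R) (Entire.incl N T.ρW R))
    (mu_incl_mem_entireVectors hcont hT N R)

theorem exists_seminorm_entireMu_le (hcont : T.IsContinuous) (hT : T.IsMalleable)
    (N : Seminorm ℝ 𝔤) (R r : ℝ≥0) (q : CS X) :
    ∃ (s : ℝ≥0) (qV : CS V) (qW : CS W), 0 < s ∧
      ∀ z, Entire.seminorm N T.ρX R r q (entireMu hcont hT N R z)
        ≤ projSeminorm (Entire.seminorm N T.ρV R s qV) (Entire.seminorm N T.ρW R s qW) z := by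
  obtain ⟨qV, qW, hq⟩ := exists_seminorm_mu_le hcont q
  refine ⟨2 ^ (R : ℝ) * (r + 1), qV, qW, mul_pos (NNReal.rpow_pos two_pos) (by positivity), ?_⟩
  refine le_projSeminorm (Q := (Entire.seminorm N T.ρX R r q).comp (entireMu hcont hT N R))
    fun v w => ?_
  rw [Entire.seminorm_apply N T.ρV, Entire.seminorm_apply N T.ρW, ← ENNReal.toReal_mul]
  exact ENNReal.toReal_mono
    (ENNReal.mul_lt_top (Entire.incl_lt_top N T.ρV R qV _ v)
      (Entire.incl_lt_top N T.ρW R qW _ w)).ne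
    (hT.analyticSeminorm_le hq R r _ _)

/-- The coefficients of `ħ ↦ μ_{F_ħ}`. -/
noncomputable def entireCoeff (hcont : T.IsContinuous) (hT : T.IsMalleable) (N : Seminorm ℝ 𝔤)
    (R : ℝ≥0) (F : ℕ → UU 𝔤) (n : ℕ) :
    Entire N T.ρV R ⊗[ℂ] Entire N T.ρW R →ₗ[ℂ] Entire N T.ρX R :=
  (n.factorial : ℂ)⁻¹ • (entireMu hcont hT N R ∘ₗ T.entireAction N R (F n))

theorem pow_smul_entireCoeff (hcont : T.IsContinuous) (hT : T.IsMalleable) (N : Seminorm ℝ 𝔤)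
    (R : ℝ≥0) (F : ℕ → UU 𝔤) (n : ℕ) (ħ : ℂ) (z : Entire N T.ρV R ⊗[ℂ] Entire N T.ρW R) :
    ħ ^ n • entireCoeff hcont hT N R F n z
      = (ħ ^ n / (n.factorial : ℂ)) • entireMu hcont hT N R (T.entireAction N R (F n) z) := by
  rw [div_eq_mul_inv, mul_smul]
  rfl

theorem EntireEquicontinuous.entireCoefficients {R : ℝ≥0} {F : ℕ → UU 𝔤}
    (hF : T.EntireEquicontinuous N R F) (hcont : T.IsContinuous) (hT : T.IsMalleable) :
    EntireCoefficients (entireCoeff hcont hT N R F) := by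
  refine .of_withSeminorms (Entire.withSeminorms N T.ρX R) ?_
  rintro ⟨r, q⟩ ρ hρ
  obtain ⟨s, qV, qW, hs, hμ⟩ := exists_seminorm_entireMu_le hcont hT N R r q
  -- The compact set {ρ} suffices: a bound at one positive real controls the coefficients at every ħ
  -- with ‖ħ‖ ≤ ρ.
  obtain ⟨qV', qW', t, C, -, hC, hbd⟩ := hF s hs qV qW {(ρ : ℂ)} isCompact_singleton
  let C' : ℝ≥0 := ⟨C, hC.le⟩
  refine ⟨projSeminorm (C' • Entire.seminorm N T.ρV R (t * s) qV')
      (Entire.seminorm N T.ρW R (t * s) qW'),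
    continuous_projSeminorm (continuous_const.mul (Entire.continuous_seminorm N T.ρV R _ _))
      (Entire.continuous_seminorm N T.ρW R _ _), fun n z => ?_⟩
  have h1 : ρ ^ n * Entire.seminorm N T.ρX R r q (entireCoeff hcont hT N R F n z)
      = Entire.seminorm N T.ρX R r q (entireMu hcont hT N R
          (((ρ : ℂ) ^ n / (n.factorial : ℂ)) • T.entireAction N R (F n) z)) := by
    rw [map_smul, ← pow_smul_entireCoeff, map_smul_eq_mul, norm_pow, Complex.norm_real,
      Real.norm_of_nonneg hρ.le]
  refine (h1.trans_le (hμ _)).trans ?_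
  exact le_projSeminorm
    (Q := (projSeminorm (Entire.seminorm N T.ρV R s qV) (Entire.seminorm N T.ρW R s qW)).comp
      (((ρ : ℂ) ^ n / (n.factorial : ℂ)) • T.entireAction N R (F n)))
    (fun v w => hbd v w ρ rfl n) z

end GTriple

end Leibniz

end UDF

open UDF in
theorem mainTheorem1
    {𝔤 : Type*} [LieRing 𝔤] [LieAlgebra ℝ 𝔤] [FiniteDimensional ℝ 𝔤]
    (N : Seminorm ℝ 𝔤) (hN : ∀ ξ : 𝔤, N ξ = 0 → ξ = 0)
    {V : Type*} [AddCommGroup V] [Module ℂ V] [TopologicalSpace V]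
    [IsTopologicalAddGroup V] [ContinuousSMul ℂ V] [LocallyConvexSpace ℝ V]
    {W : Type*} [AddCommGroup W] [Module ℂ W] [TopologicalSpace W]
    [IsTopologicalAddGroup W] [ContinuousSMul ℂ W] [LocallyConvexSpace ℝ W]
    {X : Type*} [AddCommGroup X] [Module ℂ X] [TopologicalSpace X]
    [IsTopologicalAddGroup X] [ContinuousSMul ℂ X] [LocallyConvexSpace ℝ X]
    [T2Space X] (hX : SeqComplete X)
    (T : GTriple 𝔤 V W X) (hcont : T.IsContinuous) (hmall : T.IsMalleable)
    (R : ℝ≥0) (F : ℕ → UU 𝔤) (hF : T.EntireEquicontinuous N R F) :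
    ∃ (μE : Entire N T.ρV R ⊗[ℂ] Entire N T.ρW R →ₗ[ℂ] Entire N T.ρX R)
      (μF : ℂ → Entire N T.ρV R ⊗[ℂ] Entire N T.ρW R →ₗ[ℂ] Entire N T.ρX R),
      (∀ z, Entire.incl N T.ρX R (μE z)
        = T.μ (TensorProduct.map (Entire.incl N T.ρV R) (Entire.incl N T.ρW R) z)) ∧
      (∀ (ħ : ℂ) (z : Entire N T.ρV R ⊗[ℂ] Entire N T.ρW R),
        HasSum (fun n : ℕ => (ħ ^ n / (n.factorial : ℂ)) • μE (T.entireAction N R (F n) z))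
          (μF ħ z)) ∧
      (∀ ħ : ℂ, GTriple.IsContinuous
        (⟨Entire.rep N T.ρV R, Entire.rep N T.ρW R, Entire.rep N T.ρX R, μF ħ⟩ :
          GTriple 𝔤 (Entire N T.ρV R) (Entire N T.ρW R) (Entire N T.ρX R))) ∧
      FrechetHolomorphicOn
        (fun x : ℂ × (Entire N T.ρV R ⊗[ℂ] Entire N T.ρW R) => μF x.1 x.2) Set.univ := by
  have := polynormableSpace_of_locallyConvexSpace_real X
  -- Uniqueness of sums is what makes the limit linear in z.
  have := Entire.t2Space N T.ρX R
  have hc := hF.entireCoefficients hcont hmall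
  have hE := Entire.absSummableComplete N T.ρX R hX.absSummableComplete
  obtain ⟨S, hS⟩ := hc.exists_sum hE
  have hd := hc.differentiable_sum hE hS
  refine ⟨GTriple.entireMu hcont hmall N R, S, fun _ => rfl, fun ħ z => ?_,
    fun ħ => hc.continuous_sum hS ħ, isOpen_univ, hd.continuous.continuousOn, hd.differentiableOn⟩
  simpa only [GTriple.pow_smul_entireCoeff] using hS ħ z
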